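/- Let $F$ be a field, let $L=L(X)$ be the free Lie algebra over $F$ with a free basis $X$ of two elements, and let $x\in X$. Let $N$ be the ideal of $L$ generated by $x$, and let $S$ be the ideal of $N$ generated by $x$ (the $2$-subideal of $L$ generated by $x$). View $L$ as a Lie subalgebra of the free associative algebra $A(X)$, let $A^{(n)}$ be the linear span of the words of length at most $n$ in $X$, and put $L^{(n)}=L\cap A^{(n)}$. The relative cogrowth function of $S$ in $L$ is $g_{L/S}(n)=\dim\,(L^{(n)}+S)/S$, and the graded cogrowth function is $d_{L/S}(n)=g_{L/S}(n)-g_{L/S}(n-1)$ for $n\ge 1$, $d_{L/S}(0)=g_{L/S}(0)$. Then for every $n\ge 1$ $$d_{L/S}(n)=\frac1n\sum_{d\mid n}\mu(d)\left(\mathrm{Fib}\left(\frac nd-1\right)+\mathrm{Fib}\left(\frac nd+1\right)\right),$$ where $\mu$ is the Möbius function and $\mathrm{Fib}(n)$ is the $n$th Fibonacci number ($\mathrm{Fib}(0)=0$, $\mathrm{Fib}(1)=1$). Moreover both nonnegative functions $d_{L/S}$ and $g_{L/S}$ are exponential with base the golden ratio, that is, $$\lim_{n\to\infty}\sqrt[n]{d_{L/S}(n)}=\lim_{n\to\infty}\sqrt[n]{g_{L/S}(n)}=\frac{1+\sqrt5}{2}>1.$$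 -/

import Mathlib

attribute [local instance 100] LieRing.ofAssociativeRing

noncomputable section

/-- The `ℓ`-subideal closure of a set `s` in a Lie algebra `L`: the closure of level `0` is `L`
itself, and the closure of level `ℓ + 1` is the ideal generated by `s` in the closure of level `ℓ`.
In particular level `1` is the ideal of `L` generated by `s`. -/
def subidealClosure (R : Type*) {L : Type*} [CommRing R] [LieRing L] [LieAlgebra R L]
    (s : Set L) : ℕ → LieSubalgebra R L
  | 0 => ⊤
  | ℓ + 1 =>
    let K := subidealClosure R s ℓ
    (LieIdeal.toLieSubalgebra R K (LieSubmodule.lieSpan R K {a : K | (a : L) ∈ s})).map K.incl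

/-- The canonical embedding of the free Lie algebra `L(X)` into the free associative algebra
`A(X)` with the bracket `[a, b] = a b - b a`; it is the identity on `X`. -/
def freeLieEmbedding (F X : Type*) [Field F] : FreeLieAlgebra F X →ₗ⁅F⁆ FreeAlgebra F X :=
  FreeLieAlgebra.lift F (FreeAlgebra.ι F)

/-- The degree filtration of the free associative algebra: `A(X)^(n)` is the linear span of the
words of length at most `n` in the letters `X`. -/
def freeAlgebraFiltration (F X : Type*) [Field F] (n : ℕ) : Submodule F (FreeAlgebra F X) :=
  Submodule.span F
    {a | ∃ w : List X, w.length ≤ n ∧ a = (w.map (FreeAlgebra.ι F)).prod}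

/-- The degree filtration of the free Lie algebra: `L(X)^(n) = L(X) ∩ A(X)^(n)`. -/
def freeLieFiltration (F X : Type*) [Field F] (n : ℕ) : Submodule F (FreeLieAlgebra F X) :=
  (freeAlgebraFiltration F X n).comap (freeLieEmbedding F X : FreeLieAlgebra F X →ₗ[F] FreeAlgebra F X)

section Cogrowth

variable {F V : Type*} [Field F] [AddCommGroup V] [Module F V]

/-- The cogrowth function of a subspace `W` relative to a filtration `α` of `V`:
`g_{V/W}(n) = dim (V/W)^(n)`, where `(V/W)^(n) = (V^(n) + W)/W` is the image of `V^(n)`. -/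
def cogrowth (α : ℕ → Submodule F V) (W : Submodule F V) (n : ℕ) : ℕ :=
  Module.finrank F ((α n).map W.mkQ)

/-- The graded cogrowth function `d_{V/W}(n) = g_{V/W}(n) - g_{V/W}(n - 1)`, with the convention
`V^(-1) = 0`. -/
def gradedCogrowth (α : ℕ → Submodule F V) (W : Submodule F V) : ℕ → ℤ
  | 0 => cogrowth α W 0
  | n + 1 => (cogrowth α W (n + 1) : ℤ) - cogrowth α W n

end Cogrowth

/-- `f` has nonnegative values and is exponential with base `β`: the limit of the `n`-th roots
of `f n` exists, is equal to `β`, and is greater than `1`. -/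
def HasExponentialBase (f : ℕ → ℝ) (β : ℝ) : Prop :=
  (∀ n, 0 ≤ f n) ∧ 1 < β ∧
    Filter.Tendsto (fun n : ℕ => f n ^ (1 / (n : ℝ))) Filter.atTop (nhds β)

end

/-! Let `y` be the other generator. Lazard elimination of `y` gives `L = N ⊕ F y`, where `N` is free
on the elements `(ad y)^k x`, `k ≥ 0` (`freeLieGrade_elim`, `elimLieHom_injective`,
`mem_subidealClosure_one_iff`). Since `x` is itself one of these free generators, `N / S` is free on
the remaining ones, which have degrees 2, 3, 4, .... Hence `d_{L/S}(n)` is the dimension of the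
degree `n` part of this free Lie algebra, plus 1 for `y` when `n = 1`
(`gradedCogrowth_subidealClosure_two`).

The dimensions come from a weighted Witt formula (`witt_formula`): `∑_{d ∣ n} d dim_d` is the
coefficient of `t^n` in `-t (1 - p)' / (1 - p)`, with `p` the generating function of the alphabet.
It is again proved by elimination, without PBW. Removing a letter of weight `a` lowers the dimension
in weight `a` by one and divides `1 - p` by `1 - t^a`; once all letters of weight at most `n` are
gone, nothing is left in weights up to `n`. That nothing is lost on the way rests on an action of
the free associative algebra in which the removed letter acts as a derivation
(`elimAction_elimAlgHom`). The same induction yields the embedding of `L` in `A`.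

Here `p = t^2 / (1 - t)`, so `1 - p = (1 - t - t^2) / (1 - t)`. The numerator produces the Lucas
numbers `Fib(n-1) + Fib(n+1)`; the denominator subtracts 1, which the generator `y` restores. Möbius
inversion gives the formula. Lucas numbers are `φ^n + ψ^n`, and proper divisors contribute only `O(n
φ^(n/2))`, whence the growth rate. -/

noncomputable section

/-! ### The weight grading of a free Lie algebra. -/

variable (F : Type*) [Field F] {Z : Type*}

/-- A Lie subalgebra of a free Lie algebra that contains the generators is everything. -/
theorem FreeLieAlgebra.lieSubalgebra_eq_top
    (K : LieSubalgebra F (FreeLieAlgebra F Z)) (h : ∀ z, FreeLieAlgebra.of F z ∈ K) : K = ⊤ := by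
  let f : FreeLieAlgebra F Z →ₗ⁅F⁆ K := FreeLieAlgebra.lift F fun z => ⟨FreeLieAlgebra.of F z, h z⟩
  have hf : K.incl.comp f = LieHom.id := by
    ext z
    simp [f]
  refine eq_top_iff.2 fun u _ => ?_
  have := LieHom.congr_fun hf u
  simp only [LieHom.comp_apply, LieHom.id_apply] at this
  rw [← this]
  exact (f u).2

/-- `LieMonomial F wt n u` says that `u` is an iterated bracket of letters of total weight `n`. -/
inductive LieMonomial (wt : Z → ℕ) : ℕ → FreeLieAlgebra F Z → Prop
  | of (z : Z) : LieMonomial wt (wt z) (FreeLieAlgebra.of F z)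
  | lie {i j : ℕ} {u v : FreeLieAlgebra F Z} :
      LieMonomial wt i u → LieMonomial wt j v → LieMonomial wt (i + j) ⁅u, v⁆

/-- The homogeneous component of weight `n` of the free Lie algebra on a weighted alphabet. -/
def freeLieGrade (wt : Z → ℕ) (n : ℕ) : Submodule F (FreeLieAlgebra F Z) :=
  Submodule.span F {u | LieMonomial F wt n u}

variable {F} {wt : Z → ℕ}

theorem of_mem_freeLieGrade (z : Z) : FreeLieAlgebra.of F z ∈ freeLieGrade F wt (wt z) :=
  Submodule.subset_span (LieMonomial.of z)

theorem lie_mem_freeLieGrade {i j : ℕ} {u v : FreeLieAlgebra F Z}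
    (hu : u ∈ freeLieGrade F wt i) (hv : v ∈ freeLieGrade F wt j) :
    ⁅u, v⁆ ∈ freeLieGrade F wt (i + j) := by
  induction hu using Submodule.span_induction with
  | mem u hu =>
    induction hv using Submodule.span_induction with
    | mem v hv => exact Submodule.subset_span (LieMonomial.lie hu hv)
    | zero => simp
    | add a b _ _ ha hb => rw [lie_add]; exact add_mem ha hb
    | smul c a _ ha => rw [lie_smul]; exact Submodule.smul_mem _ _ ha
  | zero => simp
  | add a b _ _ ha hb => rw [add_lie]; exact add_mem ha hb
  | smul c a _ ha => rw [smul_lie]; exact Submodule.smul_mem _ _ ha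

theorem freeLieGrade_le {n : ℕ} {p : Submodule F (FreeLieAlgebra F Z)}
    (h : ∀ u, LieMonomial F wt n u → u ∈ p) : freeLieGrade F wt n ≤ p :=
  Submodule.span_le.2 h

variable (F wt) in
theorem iSup_freeLieGrade : ⨆ n, freeLieGrade F wt n = ⊤ := by
  let K : LieSubalgebra F (FreeLieAlgebra F Z) :=
    { (⨆ n, freeLieGrade F wt n : Submodule F (FreeLieAlgebra F Z)) with
      lie_mem' := by
        intro u v hu hv
        change u ∈ ⨆ n, freeLieGrade F wt n at hu
        change v ∈ ⨆ n, freeLieGrade F wt n at hv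
        change ⁅u, v⁆ ∈ ⨆ n, freeLieGrade F wt n
        induction hu using Submodule.iSup_induction' with
        | mem i u hu =>
          induction hv using Submodule.iSup_induction' with
          | mem j v hv => exact Submodule.mem_iSup_of_mem (i + j) (lie_mem_freeLieGrade hu hv)
          | zero => simp
          | add a b _ _ ha hb => rw [lie_add]; exact add_mem ha hb
        | zero => simp
        | add a b _ _ ha hb => rw [add_lie]; exact add_mem ha hb }
  have hK : K = ⊤ := FreeLieAlgebra.lieSubalgebra_eq_top F K fun z =>
    Submodule.mem_iSup_of_mem (wt z) (of_mem_freeLieGrade z)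
  exact congrArg LieSubalgebra.toSubmodule hK

theorem LieMonomial.exists_wt_le {n : ℕ} {u : FreeLieAlgebra F Z}
    (h : LieMonomial F wt n u) : ∃ z, wt z ≤ n := by
  induction h with
  | of z => exact ⟨z, le_rfl⟩
  | lie _ _ h1 h2 => obtain ⟨z, hz⟩ := h1; exact ⟨z, by omega⟩

theorem freeLieGrade_eq_bot {n : ℕ} (h : ∀ z, n < wt z) : freeLieGrade F wt n = ⊥ :=
  eq_bot_iff.2 <| freeLieGrade_le fun u hu => by
    obtain ⟨z, hz⟩ := hu.exists_wt_le
    exact absurd (h z) (by omega)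

theorem freeLieGrade_zero (hwt : ∀ z, 1 ≤ wt z) : freeLieGrade F wt 0 = ⊥ :=
  freeLieGrade_eq_bot hwt

@[simp]
theorem freeLieEmbedding_of (z : Z) :
    freeLieEmbedding F Z (FreeLieAlgebra.of F z) = FreeAlgebra.ι F z := by
  simp [freeLieEmbedding]

variable (F wt) in
/-- The algebra homomorphism `A(Z) → A(Z)[t]` sending each letter `z` to `z t ^ wt z`. -/
def weightHom : FreeAlgebra F Z →ₐ[F] Polynomial (FreeAlgebra F Z) :=
  FreeAlgebra.lift F fun z => Polynomial.monomial (wt z) (FreeAlgebra.ι F z)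

theorem weightHom_freeLieEmbedding {n : ℕ} {u : FreeLieAlgebra F Z}
    (hu : u ∈ freeLieGrade F wt n) :
    weightHom F wt (freeLieEmbedding F Z u) =
      Polynomial.monomial n (freeLieEmbedding F Z u) := by
  induction hu using Submodule.span_induction with
  | mem u hu =>
    induction hu with
    | of z => simp [weightHom]
    | lie _ _ h1 h2 =>
      rw [LieHom.map_lie, LieRing.of_associative_ring_bracket, map_sub, map_mul, map_mul, h1, h2,
        Polynomial.monomial_mul_monomial, Polynomial.monomial_mul_monomial, map_sub, add_comm]
  | zero => simp only [map_zero]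
  | add a b _ _ ha hb => simp only [map_add, ha, hb]
  | smul c a _ ha => rw [map_smul, map_smul, ha, Polynomial.smul_monomial]

variable (F wt) in
/-- The projection of `A(Z)` onto its component of weight `n`. -/
def weightProj (n : ℕ) : FreeAlgebra F Z →ₗ[F] FreeAlgebra F Z where
  toFun a := (weightHom F wt a).coeff n
  map_add' a b := by simp
  map_smul' c a := by simp

/-- The components of `L` are defined as spans, with no independence built in; weights are separated
on the associative side, where polynomial coefficients are available. -/
theorem weightProj_freeLieEmbedding {n : ℕ} {u : FreeLieAlgebra F Z}
    (hu : u ∈ freeLieGrade F wt n) (m : ℕ) :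
    weightProj F wt m (freeLieEmbedding F Z u) =
      if n = m then freeLieEmbedding F Z u else 0 := by
  change (weightHom F wt (freeLieEmbedding F Z u)).coeff m = _
  rw [weightHom_freeLieEmbedding hu, Polynomial.coeff_monomial]

/-! ### From homogeneous components to the filtration by weight. -/

section Filtration

variable (F wt) in
/-- The span of the homogeneous components of weight at most `n`. -/
def freeLieGradeLE : ℕ → Submodule F (FreeLieAlgebra F Z)
  | 0 => freeLieGrade F wt 0
  | n + 1 => freeLieGradeLE n ⊔ freeLieGrade F wt (n + 1)

theorem freeLieGrade_le_freeLieGradeLE {m n : ℕ} (h : m ≤ n) :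
    freeLieGrade F wt m ≤ freeLieGradeLE F wt n := by
  induction n with
  | zero => obtain rfl : m = 0 := by omega
            exact le_rfl
  | succ n ih =>
    rcases h.eq_or_lt with rfl | h
    · exact le_sup_right
    · exact (ih (by omega)).trans le_sup_left

theorem freeLieGradeLE_le {n : ℕ} {p : Submodule F (FreeLieAlgebra F Z)}
    (h : ∀ m ≤ n, freeLieGrade F wt m ≤ p) : freeLieGradeLE F wt n ≤ p := by
  induction n with
  | zero => exact h 0 le_rfl
  | succ n ih => exact sup_le (ih fun m hm => h m (by omega)) (h _ le_rfl)

theorem exists_mem_freeLieGradeLE (u : FreeLieAlgebra F Z) : ∃ n, u ∈ freeLieGradeLE F wt n := by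
  have hu : u ∈ ⨆ n, freeLieGrade F wt n := by rw [iSup_freeLieGrade]; trivial
  have hmono : Monotone (freeLieGradeLE F wt) := monotone_nat_of_le_succ fun n => le_sup_left
  induction hu using Submodule.iSup_induction' with
  | mem i u hu => exact ⟨i, freeLieGrade_le_freeLieGradeLE le_rfl hu⟩
  | zero => exact ⟨0, zero_mem _⟩
  | add a b _ _ ha hb =>
    obtain ⟨i, hi⟩ := ha
    obtain ⟨j, hj⟩ := hb
    exact ⟨max i j, add_mem (hmono (le_max_left i j) hi) (hmono (le_max_right i j) hj)⟩

theorem weightProj_freeLieEmbedding_of_lt {n m : ℕ} (h : n < m) {u : FreeLieAlgebra F Z}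
    (hu : u ∈ freeLieGradeLE F wt n) : weightProj F wt m (freeLieEmbedding F Z u) = 0 := by
  have : freeLieGradeLE F wt n ≤ LinearMap.ker
      (weightProj F wt m ∘ₗ (freeLieEmbedding F Z : FreeLieAlgebra F Z →ₗ[F] FreeAlgebra F Z)) :=
    freeLieGradeLE_le fun k hk v hv => by
      have := weightProj_freeLieEmbedding hv m
      rw [if_neg (by omega)] at this
      simpa using this
  simpa using this hu

/-- The top component is peeled off repeatedly: its image is a weight projection, which vanishes, so
injectivity on one component removes it. -/
theorem mem_freeLieGradeLE_of_weightProj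
    (hinj : ∀ n, ∀ u ∈ freeLieGrade F wt n, freeLieEmbedding F Z u = 0 → u = 0)
    {N n : ℕ} (h : n ≤ N) {u : FreeLieAlgebra F Z}
    (hu : u ∈ freeLieGradeLE F wt N)
    (h0 : ∀ m, n < m → weightProj F wt m (freeLieEmbedding F Z u) = 0) :
    u ∈ freeLieGradeLE F wt n := by
  induction N with
  | zero => obtain rfl : n = 0 := by omega
            exact hu
  | succ N ih =>
    rcases h.eq_or_lt with rfl | h
    · exact hu
    · refine ih (by omega) ?_
      obtain ⟨v, hv, w, hw, rfl⟩ := Submodule.mem_sup.1 hu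
      have h1 := h0 (N + 1) (by omega)
      rw [map_add, map_add, weightProj_freeLieEmbedding_of_lt (by omega) hv,
        weightProj_freeLieEmbedding hw, if_pos rfl, zero_add] at h1
      rw [hinj _ w hw h1, add_zero]
      exact hv

theorem freeLieEmbedding_injective_of_freeLieGrade
    (hinj : ∀ n, ∀ u ∈ freeLieGrade F wt n, freeLieEmbedding F Z u = 0 → u = 0)
    (h0 : freeLieGrade F wt 0 = ⊥) :
    Function.Injective (freeLieEmbedding F Z) := by
  refine (injective_iff_map_eq_zero _).2 fun u hu => ?_
  obtain ⟨N, hN⟩ := exists_mem_freeLieGradeLE (wt := wt) u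
  have := mem_freeLieGradeLE_of_weightProj hinj (Nat.zero_le N) hN fun m _ => by simp [hu]
  rw [freeLieGradeLE, h0] at this
  exact (Submodule.mem_bot F).1 this

theorem freeLieGradeLE_inf_freeLieGrade
    (hinj : ∀ n, ∀ u ∈ freeLieGrade F wt n, freeLieEmbedding F Z u = 0 → u = 0) (n : ℕ) :
    freeLieGradeLE F wt n ⊓ freeLieGrade F wt (n + 1) = ⊥ := by
  refine eq_bot_iff.2 fun u ⟨h1, h2⟩ => ?_
  have h3 := weightProj_freeLieEmbedding_of_lt (Nat.lt_succ_self n) h1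
  rw [weightProj_freeLieEmbedding h2, if_pos rfl] at h3
  exact (Submodule.mem_bot F).2 (hinj _ u h2 h3)

end Filtration

/-! ### Lazard elimination of one letter. -/

section Elimination

variable (F : Type*) [Field F] {Z : Type*} (z : Z)

/-- The alphabet obtained by eliminating `z`: the letter `(w, k)` stands for `(ad z)^k w`. -/
abbrev ElimAlphabet : Type _ := {w : Z // w ≠ z} × ℕ

/-- The weight of `(w, k)` is the weight of `(ad z)^k w`. -/
def elimWeight (wt : Z → ℕ) (p : ElimAlphabet z) : ℕ := wt p.1 + p.2 * wt z

/-- The homomorphism of free Lie algebras sending `(w, k)` to `(ad z)^k w`. -/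
def elimLieHom : FreeLieAlgebra F (ElimAlphabet z) →ₗ⁅F⁆ FreeLieAlgebra F Z :=
  FreeLieAlgebra.lift F fun p =>
    (fun u => ⁅FreeLieAlgebra.of F z, u⁆)^[p.2] (FreeLieAlgebra.of F (p.1 : Z))

/-- The homomorphism of free associative algebras sending `(w, k)` to `(ad z)^k w`. -/
def elimAlgHom : FreeAlgebra F (ElimAlphabet z) →ₐ[F] FreeAlgebra F Z :=
  FreeAlgebra.lift F fun p =>
    (fun a => ⁅FreeAlgebra.ι F z, a⁆)^[p.2] (FreeAlgebra.ι F (p.1 : Z))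

theorem elimLieHom_of (w : {w : Z // w ≠ z}) (k : ℕ) :
    elimLieHom F z (FreeLieAlgebra.of F (w, k)) =
      (fun u => ⁅FreeLieAlgebra.of F z, u⁆)^[k] (FreeLieAlgebra.of F (w : Z)) := by
  simp [elimLieHom]

theorem elimLieHom_of_succ (w : {w : Z // w ≠ z}) (k : ℕ) :
    elimLieHom F z (FreeLieAlgebra.of F (w, k + 1)) =
      ⁅FreeLieAlgebra.of F z, elimLieHom F z (FreeLieAlgebra.of F (w, k))⁆ := by
  rw [elimLieHom_of, elimLieHom_of, Function.iterate_succ_apply']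

theorem elimAlgHom_ι (w : {w : Z // w ≠ z}) (k : ℕ) :
    elimAlgHom F z (FreeAlgebra.ι F (w, k)) =
      (fun u => ⁅FreeAlgebra.ι F z, u⁆)^[k] (FreeAlgebra.ι F (w : Z)) := by
  simp [elimAlgHom]

theorem freeLieEmbedding_elimLieHom (u : FreeLieAlgebra F (ElimAlphabet z)) :
    freeLieEmbedding F Z (elimLieHom F z u) =
      elimAlgHom F z (freeLieEmbedding F (ElimAlphabet z) u) := by
  have : (freeLieEmbedding F Z).comp (elimLieHom F z) =
      ((elimAlgHom F z : FreeAlgebra F (ElimAlphabet z) →ₗ⁅F⁆ FreeAlgebra F Z)).comp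
        (freeLieEmbedding F (ElimAlphabet z)) := by
    ext ⟨w, k⟩
    simp only [LieHom.comp_apply, elimLieHom_of, freeLieEmbedding_of]
    change _ = elimAlgHom F z _
    rw [elimAlgHom_ι]
    induction k with
    | zero => simp
    | succ k ih => rw [Function.iterate_succ_apply', Function.iterate_succ_apply', LieHom.map_lie,
        ih, freeLieEmbedding_of]
  exact LieHom.congr_fun this u

/-- The algebra homomorphism to the dual numbers that encodes the derivation `elimDeriv`. -/
def elimDualHom :
    FreeAlgebra F (ElimAlphabet z) →ₐ[F] DualNumber (FreeAlgebra F (ElimAlphabet z)) :=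
  FreeAlgebra.lift F fun p =>
    TrivSqZeroExt.inl (FreeAlgebra.ι F p) + TrivSqZeroExt.inr (FreeAlgebra.ι F (p.1, p.2 + 1))

theorem fst_elimDualHom (a : FreeAlgebra F (ElimAlphabet z)) : (elimDualHom F z a).fst = a := by
  have : (TrivSqZeroExt.fstHom F (FreeAlgebra F (ElimAlphabet z))
      (FreeAlgebra F (ElimAlphabet z))).comp (elimDualHom F z) = AlgHom.id F _ := by
    ext p
    simp [elimDualHom]
  exact AlgHom.congr_fun this a

/-- The derivation of the free associative algebra sending `(w, k)` to `(w, k + 1)`. -/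
def elimDeriv : Module.End F (FreeAlgebra F (ElimAlphabet z)) where
  toFun a := (elimDualHom F z a).snd
  map_add' a b := by simp
  map_smul' c a := by simp

theorem elimDeriv_mul (a b : FreeAlgebra F (ElimAlphabet z)) :
    elimDeriv F z (a * b) = a * elimDeriv F z b + elimDeriv F z a * b := by
  change (elimDualHom F z (a * b)).snd = _
  rw [map_mul, TrivSqZeroExt.snd_mul, fst_elimDualHom, fst_elimDualHom]
  rfl

theorem elimDeriv_one : elimDeriv F z 1 = 0 := by
  change (elimDualHom F z 1).snd = 0
  simp

theorem elimDeriv_ι (w : {w : Z // w ≠ z}) (k : ℕ) :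
    elimDeriv F z (FreeAlgebra.ι F (w, k)) = FreeAlgebra.ι F (w, k + 1) := by
  change (elimDualHom F z _).snd = _
  simp [elimDualHom]

open Classical in
/-- The action of `A(Z)` on `A(ElimAlphabet z)`: `z` acts as the derivation `elimDeriv`, any other
letter `w` as the left multiplication by `(w, 0)`. -/
def elimAction : FreeAlgebra F Z →ₐ[F] Module.End F (FreeAlgebra F (ElimAlphabet z)) :=
  FreeAlgebra.lift F fun w =>
    if h : w = z then elimDeriv F z else Algebra.lmul F _ (FreeAlgebra.ι F (⟨w, h⟩, 0))

theorem elimAction_self : elimAction F z (FreeAlgebra.ι F z) = elimDeriv F z := by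
  simp [elimAction]

/-- For a derivation `D`, the commutator of `D` with left multiplication by `b` is left
multiplication by `D b`. So `(ad z)^k w` acts as multiplication by `D^k (w, 0) = (w, k)`. Evaluating
at 1 then recovers `a`, which makes `elimAlgHom` injective. -/
theorem elimAction_elimAlgHom (a : FreeAlgebra F (ElimAlphabet z)) :
    elimAction F z (elimAlgHom F z a) = Algebra.lmul F _ a := by
  have : (elimAction F z).comp (elimAlgHom F z) = Algebra.lmul F _ := by
    ext ⟨w, k⟩ : 2
    simp only [AlgHom.coe_comp, Function.comp_apply, elimAlgHom_ι]
    induction k with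
    | zero => simp [elimAction, w.2]
    | succ k ih =>
      rw [Function.iterate_succ_apply', LieRing.of_associative_ring_bracket, map_sub, map_mul,
        map_mul, ih, elimAction_self]
      ext b : 1
      simp [elimDeriv_mul, elimDeriv_ι]
  exact AlgHom.congr_fun this a

theorem elimAlgHom_injective : Function.Injective (elimAlgHom F z) := fun a b h => by
  have := congrArg (fun f => elimAction F z f 1) h
  simpa [elimAction_elimAlgHom] using this

/-- Evaluating the action at 1 isolates `a`, because `z` acts as a derivation and kills 1. -/
theorem smul_ι_add_elimAlgHom_eq_zero {c : F} {a : FreeAlgebra F (ElimAlphabet z)}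
    (h : c • FreeAlgebra.ι F z + elimAlgHom F z a = 0) : c = 0 ∧ a = 0 := by
  have ha : a = 0 := by
    have := congrArg (fun f => elimAction F z f 1) h
    simpa [elimAction_elimAlgHom, elimAction_self, elimDeriv_one] using this
  subst ha
  refine ⟨?_, rfl⟩
  rw [map_zero, add_zero] at h
  have hz : FreeAlgebra.ι F z ≠ 0 := FreeAlgebra.ι_ne_zero z
  exact (smul_eq_zero.1 h).resolve_right hz

variable {F} {z}

/-- On letters `ad z` shifts `(w, k)` to `(w, k + 1)`, and the Leibniz rule carries this through
brackets. This makes the image of `elimLieHom` stable under `ad z`. -/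
theorem lie_of_elimLieHom_mem {wt : Z → ℕ} {j : ℕ} {v : FreeLieAlgebra F (ElimAlphabet z)}
    (hv : v ∈ freeLieGrade F (elimWeight z wt) j) :
    ⁅FreeLieAlgebra.of F z, elimLieHom F z v⁆ ∈
      (freeLieGrade F (elimWeight z wt) (j + wt z)).map
        (elimLieHom F z : FreeLieAlgebra F (ElimAlphabet z) →ₗ[F] FreeLieAlgebra F Z) := by
  induction hv using Submodule.span_induction with
  | mem v hv =>
    induction hv with
    | of p =>
      obtain ⟨w, k⟩ := p
      refine ⟨FreeLieAlgebra.of F (w, k + 1), ?_, elimLieHom_of_succ F z w k⟩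
      have e : elimWeight z wt (w, k) + wt z = elimWeight z wt (w, k + 1) := by
        simp only [elimWeight]
        ring
      rw [e]
      exact of_mem_freeLieGrade (w, k + 1)
    | @lie i j u v hu hv h1 h2 =>
      obtain ⟨u', hu', hu''⟩ := h1
      obtain ⟨v', hv', hv''⟩ := h2
      refine ⟨⁅u', v⁆ + ⁅u, v'⁆, add_mem ?_ ?_, ?_⟩
      · rw [add_right_comm]
        exact lie_mem_freeLieGrade hu' (Submodule.subset_span hv)
      · rw [add_assoc]
        exact lie_mem_freeLieGrade (Submodule.subset_span hu) hv'
      · rw [map_add]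
        change elimLieHom F z _ + elimLieHom F z _ = _
        change elimLieHom F z _ = _ at hu'' hv''
        rw [LieHom.map_lie, LieHom.map_lie, LieHom.map_lie, hu'', hv'']
        exact (leibniz_lie _ _ _).symm
  | zero => simp
  | add a b _ _ ha hb => rw [map_add, lie_add]; exact add_mem ha hb
  | smul c a _ ha => rw [map_smul, lie_smul]; exact Submodule.smul_mem _ _ ha

theorem elimLieHom_mem_freeLieGrade {wt : Z → ℕ} {n : ℕ} {v : FreeLieAlgebra F (ElimAlphabet z)}
    (hv : v ∈ freeLieGrade F (elimWeight z wt) n) : elimLieHom F z v ∈ freeLieGrade F wt n := by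
  induction hv using Submodule.span_induction with
  | mem v hv =>
    induction hv with
    | of p =>
      obtain ⟨w, k⟩ := p
      induction k with
      | zero => simpa [elimLieHom_of, elimWeight] using of_mem_freeLieGrade (F := F) (w : Z)
      | succ k ih =>
        rw [elimLieHom_of_succ]
        have e : elimWeight z wt (w, k + 1) = wt z + elimWeight z wt (w, k) := by
          simp only [elimWeight]
          ring
        rw [e]
        exact lie_mem_freeLieGrade (of_mem_freeLieGrade z) ih
    | lie _ _ h1 h2 => rw [LieHom.map_lie]; exact lie_mem_freeLieGrade h1 h2
  | zero => simp
  | add a b _ _ ha hb => rw [map_add]; exact add_mem ha hb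
  | smul c a _ ha => rw [map_smul]; exact Submodule.smul_mem _ _ ha

variable (z) in
/-- Lazard elimination, spanning part. -/
theorem freeLieGrade_elim (wt : Z → ℕ) (n : ℕ) :
    freeLieGrade F wt n =
      (freeLieGrade F (elimWeight z wt) n).map
        (elimLieHom F z : FreeLieAlgebra F (ElimAlphabet z) →ₗ[F] FreeLieAlgebra F Z) ⊔
      (if n = wt z then Submodule.span F {FreeLieAlgebra.of F z} else ⊥) := by
  set G : ℕ → Submodule F (FreeLieAlgebra F Z) := fun n =>
    (freeLieGrade F (elimWeight z wt) n).map
      (elimLieHom F z : FreeLieAlgebra F (ElimAlphabet z) →ₗ[F] FreeLieAlgebra F Z) with hG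
  set T : ℕ → Submodule F (FreeLieAlgebra F Z) := fun n =>
    if n = wt z then Submodule.span F {FreeLieAlgebra.of F z} else ⊥ with hT
  have hGG : ∀ i j, ∀ u ∈ G i, ∀ v ∈ G j, ⁅u, v⁆ ∈ G (i + j) := by
    rintro i j _ ⟨u, hu, rfl⟩ _ ⟨v, hv, rfl⟩
    exact ⟨⁅u, v⁆, lie_mem_freeLieGrade hu hv, LieHom.map_lie _ _ _⟩
  have hTs : ∀ i, ∀ u ∈ T i, ∃ c : F, c • FreeLieAlgebra.of F z = u ∧ (c = 0 ∨ i = wt z) := by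
    intro i u hu
    by_cases h : i = wt z
    · rw [hT] at hu
      simp only [if_pos h] at hu
      obtain ⟨c, hc⟩ := Submodule.mem_span_singleton.1 hu
      exact ⟨c, hc, Or.inr h⟩
    · rw [hT] at hu
      simp only [if_neg h] at hu
      exact ⟨0, by rw [zero_smul, (Submodule.mem_bot F).1 hu], Or.inl rfl⟩
  have hTG : ∀ i j, ∀ u ∈ T i, ∀ v ∈ G j, ⁅u, v⁆ ∈ G (i + j) := by
    rintro i j u hu _ ⟨v, hv, rfl⟩
    obtain ⟨c, rfl, rfl | rfl⟩ := hTs i u hu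
    · simp
    · rw [smul_lie, add_comm]
      exact Submodule.smul_mem _ _ (lie_of_elimLieHom_mem hv)
  refine le_antisymm (freeLieGrade_le fun u hu => ?_) (sup_le ?_ ?_)
  · change u ∈ G n ⊔ T n
    induction hu with
    | of w =>
      by_cases h : w = z
      · subst h
        refine Submodule.mem_sup_right ?_
        simp [hT, Submodule.mem_span_singleton_self]
      · refine Submodule.mem_sup_left ⟨FreeLieAlgebra.of F (⟨w, h⟩, 0), ?_, ?_⟩
        · convert of_mem_freeLieGrade (F := F) (wt := elimWeight z wt) (⟨w, h⟩, 0) using 1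
          simp [elimWeight]
        · exact elimLieHom_of F z ⟨w, h⟩ 0
    | @lie i j u v _ _ h1 h2 =>
      obtain ⟨u1, hu1, u2, hu2, rfl⟩ := Submodule.mem_sup.1 h1
      obtain ⟨v1, hv1, v2, hv2, rfl⟩ := Submodule.mem_sup.1 h2
      refine Submodule.mem_sup_left ?_
      -- Both are multiples of `z`, so brackets never leave the image of the new alphabet.
      have e22 : ⁅u2, v2⁆ = 0 := by
        obtain ⟨c, rfl, -⟩ := hTs i u2 hu2
        obtain ⟨d, rfl, -⟩ := hTs j v2 hv2
        simp
      rw [add_lie, lie_add, lie_add, e22, add_zero]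
      refine add_mem (add_mem (hGG _ _ _ hu1 _ hv1) ?_) (hTG _ _ _ hu2 _ hv1)
      rw [← lie_skew, add_comm i j]
      exact neg_mem (hTG _ _ _ hv2 _ hu1)
  · rintro _ ⟨v, hv, rfl⟩
    exact elimLieHom_mem_freeLieGrade hv
  · split_ifs with h
    · rw [Submodule.span_singleton_le_iff_mem, h]
      exact of_mem_freeLieGrade z
    · exact bot_le

end Elimination

/-! ### Transfer of injectivity and dimension through one elimination. -/

section EliminationStep

variable {F : Type*} [Field F] {Z : Type*} {z : Z} {wt : Z → ℕ}

theorem elimLieHom_add_smul_eq_zero {c : F} {v : FreeLieAlgebra F (ElimAlphabet z)}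
    (h : freeLieEmbedding F Z (elimLieHom F z v + c • FreeLieAlgebra.of F z) = 0) :
    c = 0 ∧ freeLieEmbedding F (ElimAlphabet z) v = 0 := by
  rw [map_add, map_smul, freeLieEmbedding_of, freeLieEmbedding_elimLieHom, add_comm] at h
  exact smul_ι_add_elimAlgHom_eq_zero F z h

theorem exists_of_mem_freeLieGrade {n : ℕ} {u : FreeLieAlgebra F Z}
    (hu : u ∈ freeLieGrade F wt n) (z : Z) :
    ∃ v ∈ freeLieGrade F (elimWeight z wt) n, ∃ c : F, (n ≠ wt z → c = 0) ∧
      u = elimLieHom F z v + c • FreeLieAlgebra.of F z := by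
  rw [freeLieGrade_elim z] at hu
  obtain ⟨_, ⟨v, hv, rfl⟩, t, ht, rfl⟩ := Submodule.mem_sup.1 hu
  split_ifs at ht with h
  · obtain ⟨c, rfl⟩ := Submodule.mem_span_singleton.1 ht
    exact ⟨v, hv, c, fun h' => absurd h h', rfl⟩
  · refine ⟨v, hv, 0, fun _ => rfl, ?_⟩
    rw [(Submodule.mem_bot F).1 ht, zero_smul]
    rfl

theorem freeLieEmbedding_injOn_of_elim {n : ℕ}
    (h : ∀ v ∈ freeLieGrade F (elimWeight z wt) n,
      freeLieEmbedding F (ElimAlphabet z) v = 0 → v = 0)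
    {u : FreeLieAlgebra F Z} (hu : u ∈ freeLieGrade F wt n) (h0 : freeLieEmbedding F Z u = 0) :
    u = 0 := by
  obtain ⟨v, hv, c, -, rfl⟩ := exists_of_mem_freeLieGrade hu z
  obtain ⟨rfl, h1⟩ := elimLieHom_add_smul_eq_zero h0
  rw [h v hv h1]
  simp

theorem of_ne_zero (z : Z) : FreeLieAlgebra.of F z ≠ 0 := fun h => by
  have := congrArg (freeLieEmbedding F Z) h
  rw [freeLieEmbedding_of, map_zero] at this
  exact FreeAlgebra.ι_ne_zero z this

theorem finite_freeLieGrade_of_elim {n : ℕ}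
    (hfin : Module.Finite F (freeLieGrade F (elimWeight z wt) n)) :
    Module.Finite F (freeLieGrade F wt n) := by
  rw [freeLieGrade_elim z]
  have h1 : Module.Finite F ((freeLieGrade F (elimWeight z wt) n).map
    (elimLieHom F z : FreeLieAlgebra F (ElimAlphabet z) →ₗ[F] FreeLieAlgebra F Z)) :=
    Module.Finite.map _ _
  by_cases h : n = wt z
  · rw [if_pos h]
    exact Submodule.finite_sup _ _
  · rw [if_neg h, sup_bot_eq]
    exact h1

/-- The sum in `freeLieGrade_elim` is direct and its first map injective, both seen after embedding
in the associative algebra; only injectivity in weight `n` for the new alphabet is needed. -/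
theorem finrank_freeLieGrade_elim {n : ℕ}
    (h : ∀ v ∈ freeLieGrade F (elimWeight z wt) n,
      freeLieEmbedding F (ElimAlphabet z) v = 0 → v = 0)
    (hfin : Module.Finite F (freeLieGrade F (elimWeight z wt) n)) :
    Module.finrank F (freeLieGrade F wt n) =
      Module.finrank F (freeLieGrade F (elimWeight z wt) n) + if n = wt z then 1 else 0 := by
  rw [freeLieGrade_elim z]
  obtain ⟨T, hT⟩ : ∃ T : Submodule F (FreeLieAlgebra F Z),
    T = if n = wt z then Submodule.span F {FreeLieAlgebra.of F z} else ⊥ := ⟨_, rfl⟩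
  rw [← hT]
  have hTf : Module.Finite F T ∧ Module.finrank F T = (if n = wt z then 1 else 0) ∧
      T ≤ Submodule.span F {FreeLieAlgebra.of F z} := by
    by_cases h : n = wt z
    · rw [if_pos h] at hT ⊢
      subst hT
      exact ⟨inferInstance, finrank_span_singleton (of_ne_zero z), le_rfl⟩
    · rw [if_neg h] at hT ⊢
      subst hT
      exact ⟨inferInstance, finrank_bot F _, bot_le⟩
  obtain ⟨_, hTr, hts⟩ := hTf
  set G := (freeLieGrade F (elimWeight z wt) n).map
    (elimLieHom F z : FreeLieAlgebra F (ElimAlphabet z) →ₗ[F] FreeLieAlgebra F Z) with hG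
  have hGr : Module.finrank F G = Module.finrank F (freeLieGrade F (elimWeight z wt) n) := by
    rw [hG, ← LinearMap.range_domRestrict]
    refine LinearMap.finrank_range_of_inj ((injective_iff_map_eq_zero _).2 fun v hv => ?_)
    change elimLieHom F z v = 0 at hv
    have h1 : freeLieEmbedding F Z
        (elimLieHom F z v + (0 : F) • FreeLieAlgebra.of F z) = 0 := by
      rw [zero_smul, add_zero, hv, map_zero]
    exact Subtype.ext (h v v.2 (elimLieHom_add_smul_eq_zero h1).2)
  have hinf : G ⊓ T = ⊥ := by
    refine eq_bot_iff.2 fun u hu => ?_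
    obtain ⟨⟨v, hv, hvu⟩, h2⟩ := hu
    obtain ⟨c, rfl⟩ := Submodule.mem_span_singleton.1 (hts h2)
    change elimLieHom F z v = _ at hvu
    have h1 : freeLieEmbedding F Z
        (elimLieHom F z v + (-c) • FreeLieAlgebra.of F z) = 0 := by
      rw [hvu, neg_smul, add_neg_cancel, map_zero]
    have := (elimLieHom_add_smul_eq_zero h1).1
    rw [neg_eq_zero.1 this, zero_smul]
    exact zero_mem _
  have := Submodule.finrank_sup_add_finrank_inf_eq G T
  rw [hinf, finrank_bot, add_zero, hGr, hTr] at this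
  exact this

end EliminationStep

/-! ### Generating functions of weighted alphabets. -/

section LetterSeries

open PowerSeries

variable {Z : Type*} (wt : Z → ℕ)

/-- The generating function of a weighted alphabet. -/
def letterSeries : PowerSeries ℚ := PowerSeries.mk fun k => ({z | wt z = k}.ncard : ℚ)

/-- The power series `- t (1 - p)' / (1 - p)`. -/
def logDerivSeries (p : PowerSeries ℚ) : PowerSeries ℚ :=
  X * d⁄dX ℚ p * (1 - p)⁻¹

variable {wt} {z : Z}

theorem finite_elimWeight (hz : 1 ≤ wt z) (hfin : ∀ k, {z | wt z = k}.Finite) (n : ℕ) :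
    {p | elimWeight z wt p = n}.Finite := by
  have h1 : {w : {w : Z // w ≠ z} | wt w ≤ n}.Finite := by
    have : {w : Z | wt w ≤ n}.Finite := by
      refine ((Set.finite_Iic n).biUnion fun k _ => hfin k).subset fun w hw => ?_
      simp only [Set.mem_iUnion]
      exact ⟨wt w, hw, rfl⟩
    exact this.preimage Subtype.val_injective.injOn
  refine (h1.prod (Set.finite_Iic n)).subset ?_
  rintro ⟨w, k⟩ h
  simp only [elimWeight, Set.mem_ofPred_eq] at h
  have : k ≤ k * wt z := Nat.le_mul_of_pos_right k hz
  exact ⟨by simp only [Set.mem_ofPred_eq]; omega, by simp only [Set.mem_Iic]; omega⟩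

/-- The letters `(w, 0)` are the old letters other than `z` (set `A`); the letters `(w, k + 1)` are
a copy of the whole new alphabet shifted by `wt z` (set `B`). -/
theorem ncard_elimWeight (hz : 1 ≤ wt z) (hfin : ∀ k, {z | wt z = k}.Finite) (n : ℕ) :
    {p | elimWeight z wt p = n}.ncard + (if n = wt z then 1 else 0) =
      {w | wt w = n}.ncard +
        if wt z ≤ n then {p | elimWeight z wt p = n - wt z}.ncard else 0 := by
  set A : Set (ElimAlphabet z) := (fun w => (w, 0)) '' {w : {w : Z // w ≠ z} | wt w = n}
  set B : Set (ElimAlphabet z) :=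
    (fun p => (p.1, p.2 + 1)) '' {p : ElimAlphabet z | elimWeight z wt p + wt z = n}
  have hAB : {p | elimWeight z wt p = n} = A ∪ B := by
    ext ⟨w, k⟩
    simp only [A, B, Set.mem_ofPred_eq, elimWeight, Set.mem_union, Set.mem_image, Prod.mk.injEq,
      Prod.exists]
    constructor
    · intro h
      cases k with
      | zero => exact Or.inl ⟨w, by simpa using h, rfl, rfl⟩
      | succ k => exact Or.inr ⟨w, k, by rw [← h]; ring, rfl, rfl⟩
    · rintro (⟨w', h, rfl, rfl⟩ | ⟨w', k', h, rfl, rfl⟩)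
      · simpa using h
      · rw [← h]; ring
  have hd : Disjoint A B := by
    rw [Set.disjoint_left]
    rintro _ ⟨w, _, rfl⟩ ⟨p, _, hp⟩
    simp at hp
  have hfinAB := finite_elimWeight hz hfin n
  rw [hAB] at hfinAB
  have hA : A.ncard + (if n = wt z then 1 else 0) = {w | wt w = n}.ncard := by
    rw [Set.ncard_image_of_injective _ (fun a b h => (Prod.mk.inj h).1)]
    rw [← Set.ncard_image_of_injective _ Subtype.val_injective]
    have e : Subtype.val '' {w : {w : Z // w ≠ z} | wt w = n} = {w | wt w = n} \ {z} := by
      ext w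
      simp [and_comm]
    rw [e]
    split_ifs with h
    · exact Set.ncard_sdiff_singleton_add_one (by simp [h]) (hfin n)
    · rw [Set.sdiff_singleton_eq_self, add_zero]
      exact fun h' => h (Eq.symm h')
  have hB : B.ncard = if wt z ≤ n then {p | elimWeight z wt p = n - wt z}.ncard else 0 := by
    rw [Set.ncard_image_of_injective]
    · split_ifs with h
      · congr 1
        ext p
        simp only [Set.mem_ofPred_eq]
        omega
      · have : {p : ElimAlphabet z | elimWeight z wt p + wt z = n} = ∅ := by
          ext p
          simp only [Set.mem_ofPred_eq, Set.mem_empty_iff_false, iff_false]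
          omega
        rw [this, Set.ncard_empty]
    · rintro ⟨a, b⟩ ⟨c, d⟩ h
      simpa using h
  rw [hAB, Set.ncard_union_eq hd (hfinAB.subset Set.subset_union_left)
    (hfinAB.subset Set.subset_union_right), ← hA, ← hB]
  ring

theorem letterSeries_elim (hz : 1 ≤ wt z) (hfin : ∀ k, {z | wt z = k}.Finite) :
    (1 - letterSeries (elimWeight z wt)) * (1 - X ^ wt z) = 1 - letterSeries wt := by
  have : letterSeries (elimWeight z wt) + X ^ wt z =
      letterSeries wt + letterSeries (elimWeight z wt) * X ^ wt z := by
    ext n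
    have := ncard_elimWeight hz hfin n
    rw [map_add, map_add, coeff_mul_X_pow', coeff_X_pow]
    simp only [letterSeries, coeff_mk]
    exact_mod_cast this
  linear_combination -this

theorem constantCoeff_letterSeries (hwt : ∀ z, 1 ≤ wt z) :
    constantCoeff (letterSeries wt) = 0 := by
  rw [← coeff_zero_eq_constantCoeff_apply, letterSeries, coeff_mk]
  have : {z | wt z = 0} = ∅ := by
    ext z
    have := hwt z
    simp only [Set.mem_ofPred_eq, Set.mem_empty_iff_false, iff_false]
    omega
  simp [this]

/-- Logarithmic derivatives turn the product into a sum, and the factor `1 - X ^ a` contributes `a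
X^a / (1 - X^a) = ∑_{k ≥ 1} a X^(k a)`. -/
theorem logDerivSeries_of_mul {p q : PowerSeries ℚ} {a : ℕ} (ha : 1 ≤ a)
    (hp : constantCoeff p = 0) (hq : constantCoeff q = 0) (h : (1 - q) * (1 - X ^ a) = 1 - p) :
    logDerivSeries p = logDerivSeries q +
      PowerSeries.mk fun n => if n ≠ 0 ∧ a ∣ n then (a : ℚ) else 0 := by
  set H : PowerSeries ℚ := PowerSeries.mk fun n => if n ≠ 0 ∧ a ∣ n then (a : ℚ) else 0 with hH
  have h1 : H * (1 - X ^ a) = (a : PowerSeries ℚ) * X ^ a := by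
    have : H = H * X ^ a + C (a : ℚ) * X ^ a := by
      ext n
      rw [map_add, coeff_mul_X_pow', coeff_C_mul, coeff_X_pow, hH, coeff_mk, coeff_mk]
      rcases lt_trichotomy n a with hlt | rfl | hgt
      · rw [if_neg, if_neg (by omega), if_neg (by omega)]
        · simp
        · rintro ⟨h0, hd⟩
          exact absurd (Nat.le_of_dvd (by omega) hd) (by omega)
      · simp
        omega
      · have e : (n ≠ 0 ∧ a ∣ n) ↔ (n - a ≠ 0 ∧ a ∣ n - a) := by
          have e0 : a ∣ n - a ↔ a ∣ n := by
            rw [Nat.dvd_sub_self_right]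
            exact or_iff_left (by omega)
          rw [e0]
          exact and_congr_left fun _ => by omega
        rw [if_pos hgt.le, if_neg (by omega : n ≠ a), mul_zero, add_zero]
        simp only [e]
    rw [map_natCast] at this
    linear_combination this
  have hD : -d⁄dX ℚ q * (1 - X ^ a) - (1 - q) * ((a : PowerSeries ℚ) * X ^ (a - 1)) =
      -d⁄dX ℚ p := by
    have := congrArg (d⁄dX ℚ) h
    simp only [Derivation.leibniz, map_sub, Derivation.leibniz_pow, smul_eq_mul, derivative_X,
      Derivation.map_one_eq_zero, nsmul_eq_mul] at this
    linear_combination this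
  have hX : (X : PowerSeries ℚ) * X ^ (a - 1) = X ^ a := by
    rw [← pow_succ', Nat.sub_add_cancel ha]
  have hp' : constantCoeff (1 - p) ≠ 0 := by simp [hp]
  have hq' : constantCoeff (1 - q) ≠ 0 := by simp [hq]
  have ip := PowerSeries.mul_inv_cancel _ hp'
  have iq := PowerSeries.mul_inv_cancel _ hq'
  have hne : (1 - p) ≠ 0 := fun h => by simp [h] at hp'
  apply mul_right_cancel₀ hne
  rw [logDerivSeries, logDerivSeries]
  have e1 : X * d⁄dX ℚ p * (1 - p)⁻¹ * (1 - p) = X * d⁄dX ℚ p := by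
    linear_combination (X * d⁄dX ℚ p) * ip
  rw [e1, ← h]
  linear_combination X * hD - (1 - q) * h1 + (1 - q) * a * hX
    - X * d⁄dX ℚ q * (1 - X ^ a) * iq

end LetterSeries

/-! ### The Witt formula and the embedding into the free associative algebra. -/

section Dimension

open PowerSeries

theorem coeff_logDerivSeries_eq_zero {p : PowerSeries ℚ} {m : ℕ} (h : ∀ k ≤ m, coeff k p = 0) :
    coeff m (logDerivSeries p) = 0 := by
  rw [logDerivSeries, coeff_mul]
  refine Finset.sum_eq_zero fun ij hij => ?_
  have : ij.1 ≤ m := by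
    have := Finset.HasAntidiagonal.mem_antidiagonal.1 hij
    omega
  obtain ⟨i, j⟩ := ij
  cases i with
  | zero => simp
  | succ i =>
    rw [coeff_succ_X_mul, coeff_derivative, h _ this]
    simp

/-- The Witt dimension formula, by induction over eliminations: `a` bounds the weights from below
and `c` letters have weight `a`. -/
theorem witt_formula_aux {F : Type*} [Field F] (n : ℕ) (b : ℕ) : ∀ (c : ℕ) {Z : Type*} (wt : Z → ℕ)
    (_ : ∀ k, {z | wt z = k}.Finite) (a : ℕ) (_ : 1 ≤ a) (_ : n + 1 ≤ a + b)
    (_ : ∀ z, a ≤ wt z) (_ : {z | wt z = a}.ncard = c) (m : ℕ) (_ : m ≤ n),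
    (∀ u ∈ freeLieGrade F wt m, freeLieEmbedding F Z u = 0 → u = 0) ∧
    Module.Finite F (freeLieGrade F wt m) ∧
    (1 ≤ m → ∑ d ∈ m.divisors, (d : ℚ) * Module.finrank F (freeLieGrade F wt d) =
      coeff m (logDerivSeries (letterSeries wt))) := by
  induction b with
  | zero =>
    intro c Z wt _ a ha hab hle _ m hm
    -- With `b = 0` every letter has weight at least `a ≥ n + 1`, so all relevant components vanish.
    have hbot : ∀ d ≤ m, freeLieGrade F wt d = ⊥ := fun d hd =>
      freeLieGrade_eq_bot fun z => by have := hle z; omega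
    refine ⟨fun u hu _ => by simpa [hbot m le_rfl] using hu, ?_, fun h1 => ?_⟩
    · rw [hbot m le_rfl]; infer_instance
    · rw [coeff_logDerivSeries_eq_zero]
      · refine Finset.sum_eq_zero fun d hd => ?_
        rw [hbot d (Nat.divisor_le hd), finrank_bot]
        simp
      · intro k hk
        have : {z | wt z = k} = ∅ := by
          ext z
          have := hle z
          simp only [Set.mem_ofPred_eq, Set.mem_empty_iff_false, iff_false]
          omega
        simp [letterSeries, this]
  | succ b ihb =>
    intro c
    induction c with
    | zero =>
      intro Z wt hfin a ha hab hle hc m hm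
      -- No letter of weight `a` is left, so the lower bound rises to `a + 1`.
      refine ihb _ wt hfin (a + 1) (by omega) (by omega) (fun z => ?_) rfl m hm
      rcases (hle z).eq_or_lt with h | h
      · rw [Set.ncard_eq_zero (hfin a)] at hc
        have : z ∈ {z | wt z = a} := h.symm
        rw [hc] at this
        exact this.elim
      · exact h
    | succ c ihc =>
      intro Z wt hfin a ha hab hle hc m hm
      obtain ⟨z, hz⟩ : {z | wt z = a}.Nonempty := by
        refine Set.nonempty_of_ncard_ne_zero ?_
        omega
      subst hz
      have hle' : ∀ p, wt z ≤ elimWeight z wt p := fun p => (hle p.1).trans (Nat.le_add_right _ _)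
      -- Letters `(w, k)` with `k ≥ 1` have weight at least `2 a > a`, so the count at weight `a`
      -- drops by exactly one.
      have hc' : {p | elimWeight z wt p = wt z}.ncard = c := by
        have := ncard_elimWeight ha hfin (wt z)
        have h0 : {p | elimWeight z wt p = wt z - wt z} = ∅ := by
          ext p
          have := hle' p
          simp only [Set.mem_ofPred_eq, Set.mem_empty_iff_false, iff_false]
          omega
        rw [h0, hc] at this
        simpa using this
      have ih := ihc (elimWeight z wt) (finite_elimWeight ha hfin) (wt z) ha hab hle' hc'
      obtain ⟨h1, h2, h3⟩ := ih m hm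
      refine ⟨fun u hu => freeLieEmbedding_injOn_of_elim h1 hu, finite_freeLieGrade_of_elim h2,
        fun hm1 => ?_⟩
      rw [logDerivSeries_of_mul ha (constantCoeff_letterSeries fun z => ha.trans (hle z))
        (constantCoeff_letterSeries fun p => ha.trans (hle' p)) (letterSeries_elim ha hfin),
        map_add, ← h3 hm1, coeff_mk]
      -- The lost dimension sits at `d = wt z`, weighted by `d`; it therefore counts exactly when
      -- `wt z ∣ m`, like the extra term in `logDerivSeries_of_mul`.
      have : ∀ d ∈ m.divisors, (d : ℚ) * Module.finrank F (freeLieGrade F wt d) =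
          (d : ℚ) * Module.finrank F (freeLieGrade F (elimWeight z wt) d) +
            if d = wt z then (wt z : ℚ) else 0 := by
        intro d hd
        have hdm := Nat.divisor_le hd
        obtain ⟨h1, h2, -⟩ := ih d (hdm.trans hm)
        rw [finrank_freeLieGrade_elim h1 h2]
        split_ifs with h
        · rw [h]; push_cast; ring
        · simp
      rw [Finset.sum_congr rfl this, Finset.sum_add_distrib, Finset.sum_ite_eq']
      simp only [Nat.mem_divisors]
      congr 2
      exact propext and_comm

variable (F : Type*) [Field F] {Z : Type*} {wt : Z → ℕ}

theorem freeLieEmbedding_injOn_freeLieGrade (hfin : ∀ k, {z | wt z = k}.Finite)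
    (hwt : ∀ z, 1 ≤ wt z) (n : ℕ) :
    ∀ u ∈ freeLieGrade F wt n, freeLieEmbedding F Z u = 0 → u = 0 :=
  (witt_formula_aux n n _ wt hfin 1 le_rfl (by omega) hwt rfl n le_rfl).1

theorem finite_freeLieGrade (hfin : ∀ k, {z | wt z = k}.Finite)
    (hwt : ∀ z, 1 ≤ wt z) (n : ℕ) : Module.Finite F (freeLieGrade F wt n) :=
  (witt_formula_aux n n _ wt hfin 1 le_rfl (by omega) hwt rfl n le_rfl).2.1

/-- The Witt dimension formula for the free Lie algebra on a weighted alphabet. -/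
theorem witt_formula (hfin : ∀ k, {z | wt z = k}.Finite)
    (hwt : ∀ z, 1 ≤ wt z) {n : ℕ} (hn : 1 ≤ n) :
    ∑ d ∈ n.divisors, (d : ℚ) * Module.finrank F (freeLieGrade F wt d) =
      coeff n (logDerivSeries (letterSeries wt)) :=
  (witt_formula_aux n n _ wt hfin 1 le_rfl (by omega) hwt rfl n le_rfl).2.2 hn

/-- The free Lie algebra embeds into the free associative algebra. -/
theorem freeLieEmbedding_injective (hfin : ∀ k, {z | wt z = k}.Finite)
    (hwt : ∀ z, 1 ≤ wt z) : Function.Injective (freeLieEmbedding F Z) :=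
  freeLieEmbedding_injective_of_freeLieGrade (freeLieEmbedding_injOn_freeLieGrade F hfin hwt)
    (freeLieGrade_zero hwt)

end Dimension

/-! ### Subideal closures. -/

section SubidealClosure

variable {R L : Type*} [CommRing R] [LieRing L] [LieAlgebra R L] {s : Set L}

theorem subset_subidealClosure (R : Type*) {L : Type*} [CommRing R] [LieRing L] [LieAlgebra R L]
    (s : Set L) (ℓ : ℕ) : s ⊆ subidealClosure R s ℓ := by
  induction ℓ with
  | zero => exact fun _ _ => LieSubalgebra.mem_top _
  | succ ℓ ih =>
    intro a ha
    refine ⟨⟨a, ih ha⟩, ?_, rfl⟩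
    exact LieSubmodule.subset_lieSpan (R := R) (L := subidealClosure R s ℓ) (by exact ha)

theorem lie_mem_subidealClosure_succ {ℓ : ℕ} {u v : L} (hu : u ∈ subidealClosure R s ℓ)
    (hv : v ∈ subidealClosure R s (ℓ + 1)) : ⁅u, v⁆ ∈ subidealClosure R s (ℓ + 1) := by
  obtain ⟨v', hv', rfl⟩ := hv
  exact ⟨⁅(⟨u, hu⟩ : subidealClosure R s ℓ), v'⁆, LieSubmodule.lie_mem _ hv', rfl⟩

/-- Minimality of the generated ideal, stated inside `L` so that later arguments avoid the nested
subtypes. -/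
theorem subidealClosure_succ_le {ℓ : ℕ} {p : Submodule R L} (hs : s ⊆ p)
    (h : ∀ u ∈ subidealClosure R s ℓ, ∀ v ∈ p, ⁅u, v⁆ ∈ p) :
    (subidealClosure R s (ℓ + 1)).toSubmodule ≤ p := by
  let I : LieSubmodule R (subidealClosure R s ℓ) (subidealClosure R s ℓ) :=
    { p.comap (subidealClosure R s ℓ).toSubmodule.subtype with
      lie_mem := fun {u v} hv => h u u.2 v hv }
  have hI : LieSubmodule.lieSpan R (subidealClosure R s ℓ)
      {a : subidealClosure R s ℓ | (a : L) ∈ s} ≤ I :=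
    LieSubmodule.lieSpan_le.2 fun a ha => hs ha
  rintro _ ⟨v, hv, rfl⟩
  exact hI hv

end SubidealClosure

/-! ### The word-length filtration compared with the weight grading. -/

section Filtration

variable {F : Type*} [Field F] {X : Type*}

theorem mul_mem_freeAlgebraFiltration {i j : ℕ} {a b : FreeAlgebra F X}
    (ha : a ∈ freeAlgebraFiltration F X i) (hb : b ∈ freeAlgebraFiltration F X j) :
    a * b ∈ freeAlgebraFiltration F X (i + j) := by
  have := Submodule.mul_mem_mul ha hb
  rw [freeAlgebraFiltration, freeAlgebraFiltration, Submodule.span_mul_span] at this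
  refine Submodule.span_mono ?_ this
  rintro _ ⟨_, ⟨w, hw, rfl⟩, _, ⟨w', hw', rfl⟩, rfl⟩
  refine ⟨w ++ w', ?_, by simp⟩
  rw [List.length_append]
  omega

theorem freeAlgebraFiltration_mono : Monotone (freeAlgebraFiltration F X) := fun _ _ h =>
  Submodule.span_mono fun _ ⟨w, hw, e⟩ => ⟨w, hw.trans h, e⟩

theorem freeLieEmbedding_mem_freeAlgebraFiltration {n : ℕ} {u : FreeLieAlgebra F X}
    (hu : u ∈ freeLieGrade F (fun _ => 1) n) :
    freeLieEmbedding F X u ∈ freeAlgebraFiltration F X n := by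
  suffices h : freeLieGrade F (fun _ => 1) n ≤ (freeAlgebraFiltration F X n).comap
    (freeLieEmbedding F X : FreeLieAlgebra F X →ₗ[F] FreeAlgebra F X) from h hu
  clear hu
  refine freeLieGrade_le fun u hu => ?_
  change freeLieEmbedding F X u ∈ freeAlgebraFiltration F X n
  induction hu with
  | of x =>
    rw [freeLieEmbedding_of]
    exact Submodule.subset_span ⟨[x], by simp, by simp⟩
  | @lie i j u v _ _ h1 h2 =>
    rw [LieHom.map_lie, LieRing.of_associative_ring_bracket]
    refine sub_mem (mul_mem_freeAlgebraFiltration h1 h2) ?_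
    rw [add_comm]
    exact mul_mem_freeAlgebraFiltration h2 h1

theorem weightHom_word (w : List X) :
    weightHom F (fun _ : X => 1) (w.map (FreeAlgebra.ι F)).prod =
      Polynomial.monomial w.length (w.map (FreeAlgebra.ι F)).prod := by
  induction w with
  | nil => simp
  | cons a w ih =>
    rw [List.map_cons, List.prod_cons, map_mul, ih, weightHom, FreeAlgebra.lift_ι_apply,
      Polynomial.monomial_mul_monomial, List.length_cons, add_comm]

theorem weightProj_eq_zero {n m : ℕ} (h : n < m) {a : FreeAlgebra F X}
    (ha : a ∈ freeAlgebraFiltration F X n) : weightProj F (fun _ : X => 1) m a = 0 := by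
  suffices h : freeAlgebraFiltration F X n ≤ LinearMap.ker (weightProj F (fun _ : X => 1) m) from
    h ha
  refine Submodule.span_le.2 ?_
  rintro _ ⟨w, hw, rfl⟩
  change (weightHom F _ _).coeff m = 0
  rw [weightHom_word, Polynomial.coeff_monomial, if_neg (by omega)]

/-- An element of `L` lying in words of length at most `n` has zero projection in every higher
degree, hence by the embedding no higher component in `L` itself. -/
theorem freeLieFiltration_eq [Finite X] (n : ℕ) :
    freeLieFiltration F X n = freeLieGradeLE F (fun _ => 1) n := by
  refine le_antisymm (fun u hu => ?_) (freeLieGradeLE_le fun m hm u hu => ?_)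
  · obtain ⟨N, hN⟩ := exists_mem_freeLieGradeLE (wt := fun _ : X => 1) u
    rcases le_total n N with h | h
    · exact mem_freeLieGradeLE_of_weightProj
        (freeLieEmbedding_injOn_freeLieGrade F (fun _ => Set.toFinite _) fun _ => le_rfl) h hN
        fun m hm => weightProj_eq_zero hm hu
    · exact freeLieGradeLE_le
        (fun m hm => freeLieGrade_le_freeLieGradeLE (hm.trans h)) hN
  · exact freeAlgebraFiltration_mono hm (freeLieEmbedding_mem_freeAlgebraFiltration hu)

end Filtration

/-! ### Dimensions of the filtration by weight. -/

section GradeLE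

variable (F : Type*) [Field F] {Z : Type*} {wt : Z → ℕ}

theorem finite_freeLieGradeLE (hfin : ∀ k, {z | wt z = k}.Finite) (hwt : ∀ z, 1 ≤ wt z) (n : ℕ) :
    Module.Finite F (freeLieGradeLE F wt n) := by
  induction n with
  | zero => exact finite_freeLieGrade F hfin hwt 0
  | succ n ih =>
    have := finite_freeLieGrade F hfin hwt (n + 1)
    exact Submodule.finite_sup _ _

theorem finrank_freeLieGradeLE_zero (hwt : ∀ z, 1 ≤ wt z) :
    Module.finrank F (freeLieGradeLE F wt 0) = 0 := by
  rw [freeLieGradeLE, freeLieGrade_zero hwt, finrank_bot]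

theorem finrank_freeLieGradeLE_succ (hfin : ∀ k, {z | wt z = k}.Finite) (hwt : ∀ z, 1 ≤ wt z)
    (n : ℕ) : Module.finrank F (freeLieGradeLE F wt (n + 1)) =
      Module.finrank F (freeLieGradeLE F wt n) + Module.finrank F (freeLieGrade F wt (n + 1)) := by
  have := finite_freeLieGradeLE F hfin hwt n
  have := finite_freeLieGrade F hfin hwt (n + 1)
  have := Submodule.finrank_sup_add_finrank_inf_eq (freeLieGradeLE F wt n)
    (freeLieGrade F wt (n + 1))
  rw [freeLieGradeLE_inf_freeLieGrade (freeLieEmbedding_injOn_freeLieGrade F hfin hwt),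
    finrank_bot, add_zero] at this
  exact this

end GradeLE

theorem elimLieHom_injective (F : Type*) [Field F] {Z : Type*} {z : Z} {wt : Z → ℕ}
    (hfin : ∀ k, {z | wt z = k}.Finite) (hwt : ∀ z, 1 ≤ wt z) :
    Function.Injective (elimLieHom F z) := by
  refine (injective_iff_map_eq_zero _).2 fun u hu => ?_
  have h := freeLieEmbedding_elimLieHom F z u
  rw [hu, map_zero] at h
  have h1 := (injective_iff_map_eq_zero _).1 (elimAlgHom_injective F z) _ h.symm
  exact (injective_iff_map_eq_zero _).1 (freeLieEmbedding_injective F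
    (finite_elimWeight (hwt z) hfin) fun p => (hwt p.1).trans (Nat.le_add_right _ _)) _ h1

/-! ### The quotient by the 2-subideal in the two-generator case. -/

section TwoGenerators

variable (F : Type*) [Field F] {X : Type*} {x y : X}

theorem exists_eq_elimLieHom_add (z : X) (u : FreeLieAlgebra F X) :
    ∃ v, ∃ c : F, u = elimLieHom F z v + c • FreeLieAlgebra.of F z := by
  have hu : u ∈ ⨆ n, freeLieGrade F (fun _ => 1) n := by rw [iSup_freeLieGrade]; trivial
  induction hu using Submodule.iSup_induction' with
  | mem i u hu =>
    obtain ⟨v, -, c, -, h⟩ := exists_of_mem_freeLieGrade hu z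
    exact ⟨v, c, h⟩
  | zero => exact ⟨0, 0, by simp⟩
  | add a b _ _ ha hb =>
    obtain ⟨v, c, rfl⟩ := ha
    obtain ⟨w, d, rfl⟩ := hb
    exact ⟨v + w, c + d, by rw [map_add, add_smul]; abel⟩

/-- The image of `elimLieHom` is an ideal: it is a subalgebra stable under `ad z`, and together with
`z` it spans everything. -/
theorem exists_elimLieHom_eq_lie (z : X) (u : FreeLieAlgebra F X)
    (v : FreeLieAlgebra F (ElimAlphabet z)) : ∃ w, elimLieHom F z w = ⁅u, elimLieHom F z v⁆ := by
  obtain ⟨u', c, rfl⟩ := exists_eq_elimLieHom_add F z u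
  have h : ∃ w, elimLieHom F z w = ⁅FreeLieAlgebra.of F z, elimLieHom F z v⁆ := by
    have hv : v ∈ ⨆ n, freeLieGrade F (elimWeight z fun _ => 1) n := by
      rw [iSup_freeLieGrade]; trivial
    induction hv using Submodule.iSup_induction' with
    | mem i v hv =>
      obtain ⟨w, -, h⟩ := lie_of_elimLieHom_mem hv
      exact ⟨w, h⟩
    | zero => exact ⟨0, by simp⟩
    | add a b _ _ ha hb =>
      obtain ⟨v, hv⟩ := ha
      obtain ⟨w, hw⟩ := hb
      exact ⟨v + w, by rw [map_add, map_add, lie_add, hv, hw]⟩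
  obtain ⟨w, hw⟩ := h
  exact ⟨⁅u', v⁆ + c • w, by rw [map_add, map_smul, LieHom.map_lie, add_lie, smul_lie, hw]⟩

/-- The homomorphism killing the letters `(w, 0)` and sending `(w, k + 1)` to `k`. -/
def killHom (y : X) : FreeLieAlgebra F (ElimAlphabet y) →ₗ⁅F⁆ FreeLieAlgebra F ℕ :=
  FreeLieAlgebra.lift F fun p => Nat.casesOn p.2 0 (FreeLieAlgebra.of F)

/-- The section of `killHom` sending `k` to `(x, k + 1)`. -/
def killSection (hxy : x ≠ y) : FreeLieAlgebra F ℕ →ₗ⁅F⁆ FreeLieAlgebra F (ElimAlphabet y) :=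
  FreeLieAlgebra.lift F fun k => FreeLieAlgebra.of F (⟨x, hxy⟩, k + 1)

theorem killHom_of_zero (w : {w : X // w ≠ y}) :
    killHom F y (FreeLieAlgebra.of F (w, 0)) = 0 := by
  simp [killHom]

theorem killHom_of_succ (w : {w : X // w ≠ y}) (k : ℕ) :
    killHom F y (FreeLieAlgebra.of F (w, k + 1)) = FreeLieAlgebra.of F k := by
  simp [killHom]

theorem killSection_of (hxy : x ≠ y) (k : ℕ) :
    killSection F hxy (FreeLieAlgebra.of F k) = FreeLieAlgebra.of F (⟨x, hxy⟩, k + 1) := by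
  simp [killSection]

theorem killHom_killSection (hxy : x ≠ y) (u : FreeLieAlgebra F ℕ) :
    killHom F y (killSection F hxy u) = u := by
  have : (killHom F y).comp (killSection F hxy) = LieHom.id := by
    ext k
    rw [LieHom.comp_apply, killSection_of, killHom_of_succ]
    rfl
  exact LieHom.congr_fun this u

variable {F}

theorem killSection_mem_freeLieGrade (hxy : x ≠ y) {n : ℕ} {u : FreeLieAlgebra F ℕ}
    (hu : u ∈ freeLieGrade F (fun k => k + 2) n) :
    killSection F hxy u ∈ freeLieGrade F (elimWeight y fun _ => 1) n := by
  suffices h : freeLieGrade F (fun k => k + 2) n ≤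
      (freeLieGrade F (elimWeight y fun _ => 1) n).comap
        (killSection F hxy : FreeLieAlgebra F ℕ →ₗ[F] FreeLieAlgebra F (ElimAlphabet y)) from h hu
  clear hu
  refine freeLieGrade_le fun u hu => ?_
  change killSection F hxy u ∈ freeLieGrade F (elimWeight y fun _ => 1) n
  induction hu with
  | of k =>
    rw [killSection_of]
    have e : k + 2 = elimWeight y (fun _ => 1) (⟨x, hxy⟩, k + 1) := by
      simp only [elimWeight]
      ring
    rw [e]
    exact of_mem_freeLieGrade _
  | lie _ _ h1 h2 => rw [LieHom.map_lie]; exact lie_mem_freeLieGrade h1 h2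

theorem killHom_mem_freeLieGrade {n : ℕ} {u : FreeLieAlgebra F (ElimAlphabet y)}
    (hu : u ∈ freeLieGrade F (elimWeight y fun _ => 1) n) :
    killHom F y u ∈ freeLieGrade F (fun k => k + 2) n := by
  suffices h : freeLieGrade F (elimWeight y fun _ => 1) n ≤
      (freeLieGrade F (fun k => k + 2) n).comap
        (killHom F y : FreeLieAlgebra F (ElimAlphabet y) →ₗ[F] FreeLieAlgebra F ℕ) from h hu
  clear hu
  refine freeLieGrade_le fun u hu => ?_
  change killHom F y u ∈ freeLieGrade F (fun k => k + 2) n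
  induction hu with
  | of p =>
    obtain ⟨w, k⟩ := p
    cases k with
    | zero => rw [killHom_of_zero]; exact zero_mem _
    | succ k =>
      rw [killHom_of_succ]
      have e : elimWeight y (fun _ => 1) (w, k + 1) = k + 2 := by
        simp only [elimWeight]
        ring
      rw [e]
      exact of_mem_freeLieGrade (wt := fun k => k + 2) k
  | lie _ _ h1 h2 => rw [LieHom.map_lie]; exact lie_mem_freeLieGrade h1 h2

variable (F)

/-- Eliminating `y` leaves the letters `(ad y)^k x`. Their span under brackets is an ideal
containing `x`, and each of them lies in the ideal generated by `x`. -/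
theorem mem_subidealClosure_one_iff (hxy : x ≠ y) (hX : ∀ w, w = x ∨ w = y)
    {u : FreeLieAlgebra F X} :
    u ∈ subidealClosure F {FreeLieAlgebra.of F x} 1 ↔ ∃ v, elimLieHom F y v = u := by
  constructor
  · intro hu
    refine subidealClosure_succ_le (p := LinearMap.range
      (elimLieHom F y : FreeLieAlgebra F (ElimAlphabet y) →ₗ[F] FreeLieAlgebra F X)) ?_ ?_ hu
    · rintro _ rfl
      exact ⟨FreeLieAlgebra.of F (⟨x, hxy⟩, 0), elimLieHom_of F y _ 0⟩
    · rintro u - _ ⟨v, rfl⟩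
      exact exists_elimLieHom_eq_lie F y u v
  · rintro ⟨v, rfl⟩
    have : (subidealClosure F {FreeLieAlgebra.of F x} 1).comap (elimLieHom F y) = ⊤ := by
      refine FreeLieAlgebra.lieSubalgebra_eq_top F _ ?_
      rintro ⟨⟨w, hw⟩, k⟩
      obtain rfl : w = x := (hX w).resolve_right hw
      change elimLieHom F y _ ∈ subidealClosure F {FreeLieAlgebra.of F w} 1
      induction k with
      | zero =>
        rw [elimLieHom_of]
        exact subset_subidealClosure F _ 1 rfl
      | succ k ih =>
        rw [elimLieHom_of_succ]
        exact lie_mem_subidealClosure_succ (LieSubalgebra.mem_top _) ih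
    have hv : v ∈ (subidealClosure F {FreeLieAlgebra.of F x} 1).comap (elimLieHom F y) := by
      rw [this]
      exact LieSubalgebra.mem_top _
    exact hv

/-- Modulo `S` each element of `N` equals its part free of the letter `(x, 0)`. The elements with
this property form a subalgebra, so generators suffice. -/
theorem elimLieHom_sub_killSection_mem (hxy : x ≠ y) (hX : ∀ w, w = x ∨ w = y)
    (u : FreeLieAlgebra F (ElimAlphabet y)) :
    elimLieHom F y (u - killSection F hxy (killHom F y u)) ∈
      subidealClosure F {FreeLieAlgebra.of F x} 2 := by
  set S := subidealClosure F {FreeLieAlgebra.of F x} 2 with hS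
  have hN : ∀ a, ∀ b ∈ S, ⁅elimLieHom F y a, b⁆ ∈ S := fun a b hb =>
    lie_mem_subidealClosure_succ ((mem_subidealClosure_one_iff F hxy hX).2 ⟨a, rfl⟩) hb
  set r : FreeLieAlgebra F (ElimAlphabet y) →ₗ⁅F⁆ FreeLieAlgebra F (ElimAlphabet y) :=
    (killSection F hxy).comp (killHom F y) with hr
  let K : LieSubalgebra F (FreeLieAlgebra F (ElimAlphabet y)) :=
    { S.toSubmodule.comap ((elimLieHom F y : FreeLieAlgebra F (ElimAlphabet y) →ₗ[F] _) ∘ₗ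
        (LinearMap.id - (r : FreeLieAlgebra F (ElimAlphabet y) →ₗ[F] _))) with
      lie_mem' := by
        intro u v hu hv
        change elimLieHom F y (u - r u) ∈ S at hu
        change elimLieHom F y (v - r v) ∈ S at hv
        change elimLieHom F y (⁅u, v⁆ - r ⁅u, v⁆) ∈ S
        -- Arranged so that the outer factors `r u` and `v` come from `N`: `S` is an ideal of `N`
        -- only, not of `L`.
        have e : ⁅u, v⁆ - r ⁅u, v⁆ = ⁅r u, v - r v⁆ - ⁅v, u - r u⁆ := by
          rw [LieHom.map_lie, lie_sub, lie_sub, ← lie_skew u v, ← lie_skew (r u) v]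
          abel
        rw [e, map_sub, LieHom.map_lie, LieHom.map_lie]
        exact sub_mem (hN _ _ hv) (hN _ _ hu) }
  have hK : K = ⊤ := by
    refine FreeLieAlgebra.lieSubalgebra_eq_top F _ ?_
    rintro ⟨⟨w, hw⟩, k⟩
    obtain rfl : w = x := (hX w).resolve_right hw
    change elimLieHom F y (FreeLieAlgebra.of F (⟨w, hw⟩, k) -
      r (FreeLieAlgebra.of F (⟨w, hw⟩, k))) ∈ S
    rw [hr, LieHom.comp_apply]
    cases k with
    | zero =>
      rw [killHom_of_zero, map_zero, sub_zero, elimLieHom_of]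
      exact subset_subidealClosure F _ 2 rfl
    | succ k =>
      rw [killHom_of_succ, killSection_of, sub_self, map_zero]
      exact zero_mem _
  have hu : u ∈ K := by
    rw [hK]
    exact LieSubalgebra.mem_top _
  exact hu

/-- The kernel of `killHom` is an ideal of the free algebra `N` containing the letter `(x, 0)`, so
its image contains `S`. -/
theorem exists_of_mem_subidealClosure_two (hxy : x ≠ y) (hX : ∀ w, w = x ∨ w = y)
    {u : FreeLieAlgebra F X} (hu : u ∈ subidealClosure F {FreeLieAlgebra.of F x} 2) :
    ∃ v, killHom F y v = 0 ∧ elimLieHom F y v = u := by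
  refine subidealClosure_succ_le (p := (LinearMap.ker
    (killHom F y : FreeLieAlgebra F (ElimAlphabet y) →ₗ[F] FreeLieAlgebra F ℕ)).map
    (elimLieHom F y : FreeLieAlgebra F (ElimAlphabet y) →ₗ[F] FreeLieAlgebra F X)) ?_ ?_ hu
  · rintro _ rfl
    exact ⟨FreeLieAlgebra.of F (⟨x, hxy⟩, 0), killHom_of_zero F _, elimLieHom_of F y _ 0⟩
  · rintro u hu _ ⟨v, hv, rfl⟩
    obtain ⟨u', rfl⟩ := (mem_subidealClosure_one_iff F hxy hX).1 hu
    refine ⟨⁅u', v⁆, ?_, LieHom.map_lie _ _ _⟩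
    change killHom F y ⁅u', v⁆ = 0
    change killHom F y v = 0 at hv
    rw [LieHom.map_lie, hv, lie_zero]

/-- The linear section over `L / S` of the free Lie algebra on the letters `(x, k + 1)`. -/
def quotSection (hxy : x ≠ y) : FreeLieAlgebra F ℕ →ₗ[F] FreeLieAlgebra F X :=
  (elimLieHom F y : FreeLieAlgebra F (ElimAlphabet y) →ₗ[F] FreeLieAlgebra F X) ∘ₗ
    (killSection F hxy : FreeLieAlgebra F ℕ →ₗ[F] FreeLieAlgebra F (ElimAlphabet y))

theorem eq_zero_of_quotSection_add_mem (hxy : x ≠ y) (hX : ∀ w, w = x ∨ w = y) {c : F}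
    {u : FreeLieAlgebra F ℕ}
    (h : quotSection F hxy u + c • FreeLieAlgebra.of F y ∈
      subidealClosure F {FreeLieAlgebra.of F x} 2) : c = 0 ∧ u = 0 := by
  have : Finite X := Set.finite_univ_iff.1 <| (Set.toFinite {x, y}).subset fun w _ => hX w
  obtain ⟨v, hv, h⟩ := exists_of_mem_subidealClosure_two F hxy hX h
  change _ = elimLieHom F y (killSection F hxy u) + _ at h
  have h0 : elimLieHom F y (killSection F hxy u - v) + c • FreeLieAlgebra.of F y = 0 := by
    rw [map_sub, h]
    abel
  obtain ⟨rfl, -⟩ := elimLieHom_add_smul_eq_zero (by rw [h0, map_zero])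
  rw [zero_smul, add_zero] at h0
  have h1 := (injective_iff_map_eq_zero _).1
    (elimLieHom_injective F (wt := fun _ => 1) (fun _ => Set.toFinite _) fun _ => le_rfl) _ h0
  have h2 := congrArg (killHom F y) h1
  rw [map_sub, killHom_killSection, hv, sub_zero, map_zero] at h2
  exact ⟨rfl, h2⟩

/-- `killHom` and `killSection` respect weights, so `L = N ⊕ F y` and the section of `N / S` are
compatible with the filtration; `y` enters from degree 1 on. -/
theorem map_mkQ_freeLieFiltration (hxy : x ≠ y) (hX : ∀ w, w = x ∨ w = y) (n : ℕ) :
    (freeLieFiltration F X n).map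
        (subidealClosure F {FreeLieAlgebra.of F x} 2).toSubmodule.mkQ =
      (freeLieGradeLE F (fun k => k + 2) n).map
        ((subidealClosure F {FreeLieAlgebra.of F x} 2).toSubmodule.mkQ ∘ₗ quotSection F hxy) ⊔
      if 1 ≤ n then Submodule.span F
        {(subidealClosure F {FreeLieAlgebra.of F x} 2).toSubmodule.mkQ (FreeLieAlgebra.of F y)}
      else ⊥ := by
  have : Finite X := Set.finite_univ_iff.1 <| (Set.toFinite {x, y}).subset fun w _ => hX w
  rw [freeLieFiltration_eq]
  set q := (subidealClosure F {FreeLieAlgebra.of F x} 2).toSubmodule.mkQ with hq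
  refine le_antisymm (Submodule.map_le_iff_le_comap.2 (freeLieGradeLE_le fun m hm u hu => ?_))
    (sup_le (Submodule.map_le_iff_le_comap.2 (freeLieGradeLE_le fun m hm u hu => ?_)) ?_)
  · obtain ⟨v, hv, c, hc, rfl⟩ := exists_of_mem_freeLieGrade hu y
    rw [Submodule.mem_comap, map_add, map_smul]
    refine Submodule.add_mem_sup ⟨killHom F y v,
      freeLieGrade_le_freeLieGradeLE hm (killHom_mem_freeLieGrade hv), ?_⟩ ?_
    · change q (elimLieHom F y (killSection F hxy (killHom F y v))) = _
      refine ((Submodule.Quotient.eq _).2 ?_).symm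
      rw [← map_sub]
      exact elimLieHom_sub_killSection_mem F hxy hX v
    · by_cases h : m = 1
      · rw [if_pos (by omega)]
        exact Submodule.smul_mem _ _ (Submodule.mem_span_singleton_self _)
      · rw [hc h, zero_smul]
        exact zero_mem _
  · refine ⟨quotSection F hxy u, freeLieGrade_le_freeLieGradeLE hm ?_, rfl⟩
    exact elimLieHom_mem_freeLieGrade (killSection_mem_freeLieGrade hxy hu)
  · split_ifs with h
    · rw [Submodule.span_singleton_le_iff_mem]
      exact ⟨_, freeLieGrade_le_freeLieGradeLE h (of_mem_freeLieGrade (wt := fun _ => 1) y), rfl⟩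
    · exact bot_le

theorem finite_setOf_add_two_eq (n : ℕ) : {k : ℕ | k + 2 = n}.Finite :=
  (Set.finite_Iic n).subset fun k (hk : k + 2 = n) => by
    simp only [Set.mem_Iic]
    omega

theorem cogrowth_subidealClosure_two (hxy : x ≠ y) (hX : ∀ w, w = x ∨ w = y) (n : ℕ) :
    cogrowth (freeLieFiltration F X)
        (subidealClosure F {FreeLieAlgebra.of F x} 2).toSubmodule n =
      Module.finrank F (freeLieGradeLE F (fun k : ℕ => k + 2) n) + if 1 ≤ n then 1 else 0 := by
  rw [cogrowth, map_mkQ_freeLieFiltration F hxy hX]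
  set q := (subidealClosure F {FreeLieAlgebra.of F x} 2).toSubmodule.mkQ with hq
  have key : ∀ (c : F) u, q (quotSection F hxy u) + c • q (FreeLieAlgebra.of F y) = 0 →
      c = 0 ∧ u = 0 := by
    intro c u h
    rw [← map_smul, ← map_add] at h
    exact eq_zero_of_quotSection_add_mem F hxy hX ((Submodule.Quotient.mk_eq_zero _).1 h)
  have hinj : Function.Injective (q ∘ₗ quotSection F hxy) := by
    refine (injective_iff_map_eq_zero _).2 fun u hu => ?_
    refine (key 0 u ?_).2
    rw [zero_smul, add_zero]
    exact hu
  have hrank : Module.finrank F ((freeLieGradeLE F (fun k => k + 2) n).map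
      (q ∘ₗ quotSection F hxy)) = Module.finrank F (freeLieGradeLE F (fun k : ℕ => k + 2) n) :=
    (LinearEquiv.finrank_eq (Submodule.equivMapOfInjective _ hinj _)).symm
  have hf := finite_freeLieGradeLE F finite_setOf_add_two_eq (fun k => by omega) n
  by_cases h : 1 ≤ n
  · rw [if_pos h, if_pos h]
    have hy : q (FreeLieAlgebra.of F y) ≠ 0 := by
      intro h0
      have := (key 1 0 (by rw [map_zero, map_zero, h0, smul_zero, add_zero])).1
      exact one_ne_zero this
    have hinf : (freeLieGradeLE F (fun k => k + 2) n).map (q ∘ₗ quotSection F hxy) ⊓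
        Submodule.span F {q (FreeLieAlgebra.of F y)} = ⊥ := by
      refine eq_bot_iff.2 ?_
      rintro _ ⟨⟨u, -, hu⟩, h2⟩
      obtain ⟨c, rfl⟩ := Submodule.mem_span_singleton.1 h2
      change q (quotSection F hxy u) = _ at hu
      have := (key (-c) u (by rw [hu, neg_smul, add_neg_cancel])).1
      rw [neg_eq_zero.1 this, zero_smul]
      exact zero_mem _
    have := Submodule.finrank_sup_add_finrank_inf_eq
      ((freeLieGradeLE F (fun k => k + 2) n).map (q ∘ₗ quotSection F hxy))
      (Submodule.span F {q (FreeLieAlgebra.of F y)})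
    rw [hinf, finrank_bot, add_zero, hrank, finrank_span_singleton hy] at this
    exact this
  · rw [if_neg h, if_neg h, sup_bot_eq, hrank, add_zero]

theorem gradedCogrowth_subidealClosure_two (hxy : x ≠ y) (hX : ∀ w, w = x ∨ w = y) {n : ℕ}
    (hn : 1 ≤ n) :
    gradedCogrowth (freeLieFiltration F X)
        (subidealClosure F {FreeLieAlgebra.of F x} 2).toSubmodule n =
      Module.finrank F (freeLieGrade F (fun k : ℕ => k + 2) n) + if n = 1 then 1 else 0 := by
  obtain ⟨n, rfl⟩ := Nat.exists_eq_add_of_le' hn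
  rw [gradedCogrowth, cogrowth_subidealClosure_two F hxy hX, cogrowth_subidealClosure_two F hxy hX,
    finrank_freeLieGradeLE_succ F finite_setOf_add_two_eq fun k => by omega]
  cases n with
  | zero =>
    simp
    ring
  | succ n => simp

end TwoGenerators

/-! ### Lucas numbers from the logarithmic derivative. -/

section Lucas

open PowerSeries

theorem logDerivSeries_X_add_X_sq :
    logDerivSeries (X + X ^ 2) = PowerSeries.mk fun n =>
      if n = 0 then 0 else (Nat.fib (n - 1) : ℚ) + Nat.fib (n + 1) := by
  set L : PowerSeries ℚ := PowerSeries.mk fun n =>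
    if n = 0 then 0 else (Nat.fib (n - 1) : ℚ) + Nat.fib (n + 1) with hL
  -- The value at 0 is set to 0 instead of the Lucas number 2, since a logarithmic derivative series
  -- has no constant term; the recurrence then needs the corrections `X` and `2 X^2`.
  have h1 : L = L * X + L * X ^ 2 + X + C 2 * X ^ 2 := by
    ext n
    rw [map_add, map_add, map_add, coeff_mul_X_pow', coeff_C_mul, coeff_X_pow, coeff_X]
    rcases n with _ | _ | _ | n
    · simp [hL]
    · simp [hL, coeff_succ_mul_X]
    · simp [hL, coeff_succ_mul_X]
      norm_num [Nat.fib]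
    · rw [coeff_succ_mul_X]
      simp only [hL, coeff_mk]
      have e1 : (Nat.fib (n + 2) : ℚ) = Nat.fib n + Nat.fib (n + 1) := by
        exact_mod_cast Nat.fib_add_two
      have e2 : (Nat.fib (n + 4) : ℚ) = Nat.fib (n + 2) + Nat.fib (n + 3) := by
        exact_mod_cast Nat.fib_add_two
      simp [e1, e2]
      ring
  have hD : d⁄dX ℚ (X + X ^ 2 : PowerSeries ℚ) = 1 + 2 * X := by
    simp [Derivation.leibniz_pow]
  have hc : constantCoeff (1 - (X + X ^ 2) : PowerSeries ℚ) ≠ 0 := by simp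
  rw [logDerivSeries, hD]
  symm
  rw [PowerSeries.eq_mul_inv_iff_mul_eq hc]
  have h2 : (C 2 : PowerSeries ℚ) = 2 := map_ofNat _ 2
  rw [h2] at h1
  linear_combination h1

theorem letterSeries_add_two :
    (1 - letterSeries fun k : ℕ => k + 2) * (1 - X ^ 1) = 1 - (X + X ^ 2) := by
  have h : (letterSeries fun k : ℕ => k + 2) = (letterSeries fun k : ℕ => k + 2) * X + X ^ 2 := by
    have hc : ∀ n : ℕ, {k : ℕ | k + 2 = n}.ncard = if 2 ≤ n then 1 else 0 := by
      intro n
      split_ifs with h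
      · rw [Set.ncard_eq_one]
        refine ⟨n - 2, ?_⟩
        ext k
        simp only [Set.mem_ofPred_eq, Set.mem_singleton_iff]
        omega
      · have : {k : ℕ | k + 2 = n} = ∅ := by
          ext k
          simp only [Set.mem_ofPred_eq, Set.mem_empty_iff_false, iff_false]
          omega
        rw [this, Set.ncard_empty]
    ext n
    rw [map_add, coeff_X_pow]
    cases n with
    | zero => simp [letterSeries, hc]
    | succ n =>
      rw [coeff_succ_mul_X]
      simp only [letterSeries, coeff_mk, hc]
      rcases lt_trichotomy n 1 with h | rfl | h
      · rw [if_neg (by omega), if_neg (by omega), if_neg (by omega)]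
        simp
      · simp
      · rw [if_pos (by omega), if_pos (by omega), if_neg (by omega)]
        simp
  rw [pow_one]
  linear_combination -h

/-- The summand 1 is the coefficient coming from the factor `1 - X ^ 1`, as if a letter of weight 1
had been eliminated. -/
theorem sum_divisors_finrank_freeLieGrade_add_two (F : Type*) [Field F] {n : ℕ} (hn : 1 ≤ n) :
    ∑ d ∈ n.divisors, (d : ℚ) * Module.finrank F (freeLieGrade F (fun k : ℕ => k + 2) d) + 1 =
      (Nat.fib (n - 1) : ℚ) + Nat.fib (n + 1) := by
  have h := logDerivSeries_of_mul (p := X + X ^ 2) (q := letterSeries fun k : ℕ => k + 2) le_rfl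
    (by simp) (constantCoeff_letterSeries fun k => by omega) letterSeries_add_two
  rw [logDerivSeries_X_add_X_sq] at h
  have h := congrArg (coeff n) h
  rw [map_add, coeff_mk, coeff_mk, if_neg (by omega), if_pos ⟨by omega, one_dvd n⟩,
    ← witt_formula F finite_setOf_add_two_eq (fun k => by omega) hn] at h
  rw [h]
  simp

end Lucas

/-! ### Growth of sequences with Lucas divisor sums. -/

section Asymptotics

open Real Filter Topology goldenRatio

theorem fib_sub_one_add_fib_add_one {n : ℕ} (hn : 1 ≤ n) :
    (Nat.fib (n - 1) : ℝ) + Nat.fib (n + 1) = φ ^ n + ψ ^ n := by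
  obtain ⟨n, rfl⟩ := Nat.exists_eq_add_of_le' hn
  rw [Nat.add_sub_cancel]
  have h1 := fib_succ_sub_goldenRatio_mul_fib (n + 1)
  have h3 := fib_succ_sub_goldenConj_mul_fib (n + 1)
  have h5 : (Nat.fib (n + 1 + 1) : ℝ) = Nat.fib n + Nat.fib (n + 1) := by
    exact_mod_cast Nat.fib_add_two
  have h6 : φ + ψ = 1 := goldenRatio_add_goldenConj
  linear_combination h1 + h3 - h5 + h6 * Nat.fib (n + 1)

theorem abs_goldenConj_pow_le_one (n : ℕ) : |ψ ^ n| ≤ 1 := by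
  rw [abs_pow]
  refine pow_le_one₀ (abs_nonneg _) (abs_le.2 ⟨neg_one_lt_goldenConj.le, ?_⟩)
  linarith [goldenConj_neg]

/-- Constants and factors `n` disappear under the `n`-th root. -/
theorem tendsto_rpow_inv_of_bounds {f : ℕ → ℝ} {β : ℝ} (hβ : 0 < β)
    (hlow : ∀ᶠ n : ℕ in atTop, β ^ n / (2 * n) ≤ f n)
    (hup : ∀ᶠ n : ℕ in atTop, f n ≤ 4 * n * β ^ n) :
    Tendsto (fun n : ℕ => f n ^ (1 / (n : ℝ))) atTop (𝓝 β) := by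
  have hn : Tendsto (fun n : ℕ => (n : ℝ) ^ (1 / (n : ℝ))) atTop (𝓝 1) :=
    tendsto_rpow_div.comp tendsto_natCast_atTop_atTop
  have hc : ∀ c : ℝ, 0 < c → Tendsto (fun n : ℕ => c ^ (1 / (n : ℝ))) atTop (𝓝 1) := by
    intro c hc
    have := (Real.continuousAt_const_rpow hc.ne' (b := 0)).tendsto.comp
      tendsto_one_div_atTop_nhds_zero_nat
    rw [Real.rpow_zero] at this
    exact this
  have hpow : ∀ n : ℕ, 1 ≤ n → (β ^ n) ^ (1 / (n : ℝ)) = β := fun n hn => by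
    rw [one_div]
    exact Real.pow_rpow_inv_natCast hβ.le (by omega)
  have h1 : Tendsto (fun n : ℕ => β / ((2 : ℝ) ^ (1 / (n : ℝ)) * (n : ℝ) ^ (1 / (n : ℝ)))) atTop
      (𝓝 β) := by
    have := (tendsto_const_nhds (x := β)).div ((hc 2 two_pos).mul hn) (by norm_num)
    rw [mul_one, div_one] at this
    exact this
  have h2 : Tendsto (fun n : ℕ => (4 : ℝ) ^ (1 / (n : ℝ)) * (n : ℝ) ^ (1 / (n : ℝ)) * β) atTop
      (𝓝 β) := by
    have := ((hc 4 (by norm_num)).mul hn).mul_const β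
    simpa using this
  refine tendsto_of_tendsto_of_tendsto_of_le_of_le' h1 h2 ?_ ?_
  · filter_upwards [hlow, eventually_ge_atTop 1] with n hn h1
    calc _ = (β ^ n / (2 * n)) ^ (1 / (n : ℝ)) := by
          rw [Real.div_rpow (by positivity) (by positivity), hpow n h1,
            Real.mul_rpow (by positivity) (by positivity)]
      _ ≤ _ := Real.rpow_le_rpow (by positivity) hn (by positivity)
  · filter_upwards [hlow, hup, eventually_ge_atTop 1] with n hl hn h1
    have h0 : 0 ≤ f n := le_trans (by positivity) hl
    calc _ ≤ (4 * n * β ^ n) ^ (1 / (n : ℝ)) := Real.rpow_le_rpow h0 hn (by positivity)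
      _ = _ := by
          rw [Real.mul_rpow (by positivity) (by positivity), hpow n h1,
            Real.mul_rpow (by positivity) (by positivity)]

/-- A nonnegative sequence with `∑ d ∣ n, d f(d)` equal to the Lucas number of index `n` is at most
`2 φ ^ n`. -/
theorem le_of_sum_divisors_eq_lucas {f : ℕ → ℝ} (h0 : ∀ n : ℕ, 0 ≤ f n)
    (h : ∀ n : ℕ, 1 ≤ n → ∑ d ∈ n.divisors, (d : ℝ) * f d = Nat.fib (n - 1) + Nat.fib (n + 1))
    {n : ℕ}
    (hn : 1 ≤ n) : (n : ℝ) * f n ≤ 2 * φ ^ n := by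
  have h1 : (n : ℝ) * f n ≤ ∑ d ∈ n.divisors, (d : ℝ) * f d :=
    Finset.single_le_sum (f := fun d : ℕ => (d : ℝ) * f d)
      (fun d _ => mul_nonneg (Nat.cast_nonneg d) (h0 d)) (Nat.mem_divisors_self n (by omega))
  rw [h n hn, fib_sub_one_add_fib_add_one hn] at h1
  have h2 := (abs_le.1 (abs_goldenConj_pow_le_one n)).2
  have h3 : 1 ≤ φ ^ n := one_le_pow₀ one_lt_goldenRatio.le
  linarith

/-- There are at most `n` proper divisors, each at most `n / 2`, so by the upper bound they take
only `2 n φ^(n/2)` away from `φ^n + ψ^n`. -/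
theorem eventually_le_of_sum_divisors_eq_lucas {f : ℕ → ℝ} (h0 : ∀ n : ℕ, 0 ≤ f n)
    (h : ∀ n : ℕ, 1 ≤ n → ∑ d ∈ n.divisors, (d : ℝ) * f d = Nat.fib (n - 1) + Nat.fib (n + 1)) :
    ∀ᶠ n : ℕ in atTop, φ ^ n / (2 * n) ≤ f n := by
  have hφ := one_lt_goldenRatio
  have key : ∀ n : ℕ, 1 ≤ n → φ ^ n - 1 - n * (2 * φ ^ (n / 2)) ≤ n * f n := by
    intro n hn
    have h1 := h n hn
    rw [fib_sub_one_add_fib_add_one hn, ← Nat.insert_self_properDivisors (by omega),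
      Finset.sum_insert Nat.self_notMem_properDivisors] at h1
    have h2 : ∑ d ∈ n.properDivisors, (d : ℝ) * f d ≤ n * (2 * φ ^ (n / 2)) := by
      have hb : ∀ d ∈ n.properDivisors, (d : ℝ) * f d ≤ 2 * φ ^ (n / 2) := by
        intro d hd
        obtain ⟨hd, hlt⟩ := Nat.mem_properDivisors.1 hd
        have hd1 : 1 ≤ d := Nat.pos_of_dvd_of_pos hd (by omega)
        refine (le_of_sum_divisors_eq_lucas h0 h hd1).trans ?_
        have hd2 : d ≤ n / 2 := by
          obtain ⟨k, rfl⟩ := hd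
          have hk : 2 ≤ k := by
            by_contra hk
            have : k = 0 ∨ k = 1 := by omega
            rcases this with rfl | rfl <;> simp at hlt hn
          rw [Nat.le_div_iff_mul_le two_pos]
          exact Nat.mul_le_mul_left d hk
        have := pow_le_pow_right₀ hφ.le hd2
        linarith
      refine (Finset.sum_le_card_nsmul _ _ _ hb).trans ?_
      rw [nsmul_eq_mul]
      have hcard : (n.properDivisors.card : ℝ) ≤ n := by
        have h1 : n.properDivisors.card ≤ (Finset.range n).card := Finset.card_le_card fun d hd =>
          Finset.mem_range.2 (Nat.mem_properDivisors.1 hd).2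
        rw [Finset.card_range] at h1
        exact_mod_cast h1
      exact mul_le_mul_of_nonneg_right hcard (by positivity)
    have h3 := (abs_le.1 (abs_goldenConj_pow_le_one n)).1
    linarith
  -- The error is at most `1 + 2 n √φ^n ≤ 3 n √φ^n`; the constant 5 leaves room.
  have hlim : Tendsto (fun n : ℕ => 5 * ((n : ℝ) * (√φ)⁻¹ ^ n)) atTop (𝓝 0) := by
    have h1 : 1 < √φ := by
      rw [Real.lt_sqrt zero_le_one]
      linarith
    have := tendsto_self_mul_const_pow_of_lt_one (r := (√φ)⁻¹) (by positivity)
      (inv_lt_one_of_one_lt₀ h1)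
    simpa using this.const_mul 5
  filter_upwards [hlim.eventually_le_const (by norm_num : (0 : ℝ) < 1 / 2),
    eventually_ge_atTop 1] with n hsmall hn
  have hs : 0 < √φ := Real.sqrt_pos.2 goldenRatio_pos
  have hsq : √φ ^ n * √φ ^ n = φ ^ n := by
    rw [← mul_pow, Real.mul_self_sqrt goldenRatio_pos.le]
  have h1s : 1 ≤ √φ := by
    rw [Real.le_sqrt' one_pos]
    linarith
  have hhalf : φ ^ (n / 2) ≤ √φ ^ n := by
    calc φ ^ (n / 2) = √φ ^ (2 * (n / 2)) := by
          rw [pow_mul, Real.sq_sqrt goldenRatio_pos.le]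
      _ ≤ √φ ^ n := pow_le_pow_right₀ h1s (Nat.mul_div_le n 2)
  have hn1 : (1 : ℝ) ≤ n := by exact_mod_cast hn
  have hpos : 0 < √φ ^ n := by positivity
  have h5 : 5 * (n : ℝ) * √φ ^ n ≤ φ ^ n / 2 := by
    rw [inv_pow] at hsmall
    have := mul_le_mul_of_nonneg_right hsmall (by positivity : 0 ≤ √φ ^ n * √φ ^ n)
    have e : 5 * ((n : ℝ) * (√φ ^ n)⁻¹) * (√φ ^ n * √φ ^ n) = 5 * (n : ℝ) * √φ ^ n := by
      field_simp
    rw [e, hsq] at this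
    linarith
  have h6 : (n : ℝ) * (2 * φ ^ (n / 2)) ≤ n * (2 * √φ ^ n) := by gcongr
  have h7 : 1 ≤ (n : ℝ) * √φ ^ n := one_le_mul_of_one_le_of_one_le hn1 (one_le_pow₀ h1s)
  rw [div_le_iff₀ (by positivity)]
  have := key n hn
  nlinarith

end Asymptotics

end

/-! ### The main theorem. -/

theorem mainTheorem12 (F : Type*) [Field F] (X : Type*) (hX : Nat.card X = 2) (x : X)
    (S : LieSubalgebra F (FreeLieAlgebra F X))
    (hS : S = subidealClosure F {FreeLieAlgebra.of F x} 2) :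
    (∀ n : ℕ, 1 ≤ n →
      (gradedCogrowth (freeLieFiltration F X) S.toSubmodule n : ℚ) =
        (1 / (n : ℚ)) * ∑ d ∈ n.divisors, (ArithmeticFunction.moebius d : ℚ) *
          ((Nat.fib (n / d - 1) : ℚ) + (Nat.fib (n / d + 1) : ℚ))) ∧
    HasExponentialBase
      (fun n => (gradedCogrowth (freeLieFiltration F X) S.toSubmodule n : ℝ))
      ((1 + √5) / 2) ∧
    HasExponentialBase
      (fun n => (cogrowth (freeLieFiltration F X) S.toSubmodule n : ℝ))
      ((1 + √5) / 2) := by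
  subst hS
  obtain ⟨y, hyx, hy⟩ := Nat.card_eq_two_iff' x |>.1 hX
  have hX' : ∀ w, w = x ∨ w = y := fun w => or_iff_not_imp_left.2 fun h => hy w h
  have hxy : x ≠ y := hyx.symm
  set D := gradedCogrowth (freeLieFiltration F X)
    (subidealClosure F {FreeLieAlgebra.of F x} 2).toSubmodule with hD
  set g := cogrowth (freeLieFiltration F X)
    (subidealClosure F {FreeLieAlgebra.of F x} 2).toSubmodule with hg
  have hD1 : ∀ n : ℕ, 1 ≤ n → D n = Module.finrank F (freeLieGrade F (fun k : ℕ => k + 2) n) +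
      if n = 1 then 1 else 0 := fun n hn => gradedCogrowth_subidealClosure_two F hxy hX' hn
  have hg0 : g 0 = 0 := by
    rw [hg, cogrowth_subidealClosure_two F hxy hX', finrank_freeLieGradeLE_zero F fun k => by omega]
    simp
  -- The extra 1 at `d = 1`, due to `y`, enters every divisor sum once and completes it to the Lucas
  -- number.
  have hsum : ∀ n : ℕ, 1 ≤ n →
      ∑ d ∈ n.divisors, (d : ℚ) * (D d : ℚ) = Nat.fib (n - 1) + Nat.fib (n + 1) := by
    intro n hn
    rw [← sum_divisors_finrank_freeLieGrade_add_two F hn]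
    have : ∀ d ∈ n.divisors, (d : ℚ) * (D d : ℚ) =
        (d : ℚ) * Module.finrank F (freeLieGrade F (fun k : ℕ => k + 2) d) +
          if d = 1 then 1 else 0 := by
      intro d hd
      rw [hD1 d (Nat.pos_of_mem_divisors hd)]
      split_ifs with h
      · rw [h]; push_cast; ring
      · simp
    rw [Finset.sum_congr rfl this, Finset.sum_add_distrib, Finset.sum_ite_eq',
      if_pos (Nat.one_mem_divisors.2 (by omega))]
  have hsumR : ∀ n : ℕ, 1 ≤ n →
      ∑ d ∈ n.divisors, (d : ℝ) * (D d : ℝ) = Nat.fib (n - 1) + Nat.fib (n + 1) := by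
    intro n hn
    exact_mod_cast congrArg (fun r : ℚ => (r : ℝ)) (hsum n hn)
  have hDnonneg : ∀ n : ℕ, (0 : ℝ) ≤ D n := by
    intro n
    rcases Nat.eq_zero_or_pos n with rfl | hn
    · have : D 0 = g 0 := rfl
      rw [this]
      positivity
    · rw [hD1 n hn]
      split_ifs <;> push_cast <;> positivity
  have hgsucc : ∀ n : ℕ, (g (n + 1) : ℝ) = g n + D (n + 1) := by
    intro n
    have : D (n + 1) = (g (n + 1) : ℤ) - g n := rfl
    rw [this]
    push_cast
    ring
  have hDle : ∀ n : ℕ, 1 ≤ n → (n : ℝ) * D n ≤ 2 * Real.goldenRatio ^ n := fun n hn =>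
    le_of_sum_divisors_eq_lucas hDnonneg hsumR hn
  have hDle' : ∀ n : ℕ, 1 ≤ n → (D n : ℝ) ≤ 2 * Real.goldenRatio ^ n := fun n hn => by
    have h1 : (1 : ℝ) ≤ n := by exact_mod_cast hn
    have := le_mul_of_one_le_left (hDnonneg n) h1
    exact this.trans (hDle n hn)
  have hφ := Real.goldenRatio_pos
  have hgle : ∀ n : ℕ, (g n : ℝ) ≤ 2 * n * Real.goldenRatio ^ n := by
    intro n
    induction n with
    | zero => simp [hg0]
    | succ n ih =>
      rw [hgsucc]
      have h1 := hDle' (n + 1) (by omega)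
      have h2 : Real.goldenRatio ^ n ≤ Real.goldenRatio ^ (n + 1) :=
        pow_le_pow_right₀ Real.one_lt_goldenRatio.le (Nat.le_succ n)
      have h3 : 2 * (n : ℝ) * Real.goldenRatio ^ n ≤ 2 * n * Real.goldenRatio ^ (n + 1) := by gcongr
      push_cast
      linarith
  have hDg : ∀ n : ℕ, (D n : ℝ) ≤ g n := by
    intro n
    cases n with
    | zero => exact le_of_eq rfl
    | succ n =>
      rw [hgsucc]
      have : (0 : ℝ) ≤ g n := by positivity
      linarith
  have hlow := eventually_le_of_sum_divisors_eq_lucas hDnonneg hsumR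
  have hgup : ∀ n : ℕ, (g n : ℝ) ≤ 4 * n * Real.goldenRatio ^ n := fun n => by
    have := hgle n
    have : 0 ≤ (n : ℝ) * Real.goldenRatio ^ n := by positivity
    linarith
  refine ⟨fun n hn => ?_, ⟨hDnonneg, Real.one_lt_goldenRatio, ?_⟩,
    fun n => Nat.cast_nonneg _, Real.one_lt_goldenRatio, ?_⟩
  · have h := ArithmeticFunction.sum_eq_iff_sum_mul_moebius_eq.1 hsum n hn
    rw [Nat.sum_divisorsAntidiagonal (fun a b => (ArithmeticFunction.moebius a : ℚ) *
      ((Nat.fib (b - 1) : ℚ) + Nat.fib (b + 1)))] at h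
    rw [h]
    have : (n : ℚ) ≠ 0 := by positivity
    field_simp
  -- The lower bound for `D` and the upper bound for `g` serve both functions, because `D ≤ g`.
  · exact tendsto_rpow_inv_of_bounds hφ hlow
      (Filter.Eventually.of_forall fun n => (hDg n).trans (hgup n))
  · exact tendsto_rpow_inv_of_bounds hφ (hlow.mono fun n hn => hn.trans (hDg n))
      (Filter.Eventually.of_forall hgup)
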